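/- **Setting.** Let $R$ be a finite commutative local principal ideal ring of odd characteristic, with maximal ideal $\mathfrak m=Rx$ of nilpotency degree $\ell\ge 1$. Let $A=R[y]=R\oplus Ry$ with $y^2=x$, with involution $(r+sy)^*=r-sy$ and $R$-linear map $d(r+sy)=2s$. Let $V$ be a non-zero free $A$-module of finite rank and $h:V\times V\to A$ a non-degenerate $*$-hermitian form (linear in the second variable; non-degenerate means that $v\mapsto h(v,-)$ is a bijection $V\to \mathrm{Hom}_A(V,A)$), with unitary group $U$. For $j\ge 0$ let $U(y^j)=\{g\in U: gv\equiv v \bmod y^jV \text{ for all } v\in V\}$. Let $\lambda:R^+\to\mathbb C^\times$ be a primitive linear character (its kernel contains no non-zero ideal) and $\mu(a)=\lambda(d(a))$ for $a\in A$. For a bi-additive map $f:V'\times V'\to B$ let $G(f)$ be the group of additive automorphisms of $V'$ preserving $f$ and $H(f)$ the Heisenberg group of all pairs $(b,v)\in B\times V'$ with $(a,v)(b,w)=(a+b+f(v,w),v+w)$. A Schrödinger representation of $H(f)$ of type $\psi$, where $\psi$ is a linear character of $B^+$, is an irreducible complex representation $S$ on which $(B,0)$ acts through $\psi$ and which is $G(f)$-invariant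 (for every $g\in G(f)$, $S$ is equivalent to $(b,v)\mapsto S(b,gv)$). A Weil representation of type $\psi$ of the unitary group of a form $f$ is a representation $W$ of that group on the space of such an $S$ with $W(g)S(b,v)W(g)^{-1}=S(b,gv)$ for all $g$ in the group and $(b,v)\in H(f)$. Put $V_0=y^\ell V$. Then $\rho(a,u)=\mu(a)$ is a linear character of the subgroup $(A,V_0)$ of $H(h)$; extend it to $(A,V_0)\rtimes U$ trivially on $U$. Let $X=\mathrm{ind}_{(A,V_0)\rtimes U}^{H(h)\rtimes U}\,\mathbb C\zeta$ be the induced module and $e_v=(0,v)\otimes\zeta$ for $v\in V$. Let $Top$ and $Bot$ be the $U$-submodules of $X$ spanned by the $e_v$ with $v\notin yV$ and with $v\in yV$, respectively. **Theorem.** (a) $U(y^{2(\ell-1)})$ acts trivially on $Bot$. (b) $U(y^{2(\ell-1)})$ acts non-trivially on every irreducible constituent of $Top$. (c) Suppose $\ell>1$. Let $\overline A=A/y^{2(\ell-1)}A$ with the induced involution, $\overline V=V/y^{2(\ell-1)}V$, $\overline h:\overline V\times\overline V\to\overline A$ the form induced by $h$, and $\overline U$ the unitary group of $\overline h$. The natural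 homomorphism $U\to\overline U$ is surjective with kernel $U(y^{2(\ell-1)})$; the linear character $\overline\mu(a+y^{2(\ell-1)}A)=\mu(-y^2a)$ of $\overline A^+$ is primitive; and the representation of $\overline U\cong U/U(y^{2(\ell-1)})$ on $Bot$ is a Weil representation of type $\overline\mu$. -/

import Mathlib

namespace RamifiedWeil

noncomputable section

/-! ### Heisenberg groups and Schroedinger representations of bi-additive maps -/

section Biadditive

variable {B V : Type*} [AddCommGroup B] [AddCommGroup V]

/-- The Heisenberg group `H(f)` of a bi-additive map `f : V × V → B`: pairs `(b, v)`, multiplied by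
`(a, v) (b, w) = (a + b + f(v, w), v + w)`. -/
@[ext]
structure Heisenberg (f : V →+ V →+ B) where
  center : B
  vec : V

namespace Heisenberg

variable {f : V →+ V →+ B}

instance : Mul (Heisenberg f) := ⟨fun k l => ⟨k.center + l.center + f k.vec l.vec, k.vec + l.vec⟩⟩
instance : One (Heisenberg f) := ⟨⟨0, 0⟩⟩
instance : Inv (Heisenberg f) := ⟨fun k => ⟨-k.center + f k.vec k.vec, -k.vec⟩⟩

@[simp] lemma mul_center (k l : Heisenberg f) :
    (k * l).center = k.center + l.center + f k.vec l.vec := rfl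
@[simp] lemma mul_vec (k l : Heisenberg f) : (k * l).vec = k.vec + l.vec := rfl
@[simp] lemma one_center : (1 : Heisenberg f).center = 0 := rfl
@[simp] lemma one_vec : (1 : Heisenberg f).vec = 0 := rfl
@[simp] lemma inv_center (k : Heisenberg f) : k⁻¹.center = -k.center + f k.vec k.vec := rfl
@[simp] lemma inv_vec (k : Heisenberg f) : k⁻¹.vec = -k.vec := rfl

instance : Group (Heisenberg f) :=
  Group.ofLeftAxioms
    (fun a b c => by
      ext
      · simp only [mul_center, mul_vec, map_add, AddMonoidHom.add_apply]; abel
      · simp only [mul_vec]; abel)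
    (fun a => by ext <;> simp)
    (fun a => by ext <;> simp)

/-- The action `(b, v) ↦ (b, g v)` on `H(f)` of a map `g : V → V`. -/
def act (g : V → V) (k : Heisenberg f) : Heisenberg f := ⟨k.center, g k.vec⟩

@[simp] lemma act_center (g : V → V) (k : Heisenberg f) : (act g k).center = k.center := rfl
@[simp] lemma act_vec (g : V → V) (k : Heisenberg f) : (act g k).vec = g k.vec := rfl

end Heisenberg

/-- The isometry group `G(f)`: all automorphisms of the additive group `V` that preserve `f`. -/
def isometryGroup (f : V →+ V →+ B) : Set (V ≃+ V) := {g | ∀ u v, f (g u) (g v) = f u v}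

/-- `S` is a Schroedinger representation of `H(f)` of type `ψ`: it is irreducible, the central
subgroup `B` acts through the linear character `ψ`, and `S` is `G(f)`-invariant, that is,
equivalent to each of its conjugates `k ↦ S (g k)` with `g ∈ G(f)`. -/
structure IsSchroedinger (f : V →+ V →+ B) (ψ : AddChar B ℂ) {X : Type*} [AddCommGroup X]
    [Module ℂ X] (S : Representation ℂ (Heisenberg f) X) : Prop where
  irreducible : S.IsIrreducible
  central : ∀ (b : B) (F : X), S ⟨b, 0⟩ F = ψ b • F
  invariant : ∀ g ∈ isometryGroup f, ∃ P : X ≃ₗ[ℂ] X, ∀ (k : Heisenberg f) (F : X),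
    P (S k F) = S (k.act g) (P F)

end Biadditive

/-! ### Sesquilinear forms: unitary groups, Weil representations, reduction modulo an ideal -/

section Sesquilinear

variable {B V : Type*} [CommRing B] [AddCommGroup V] [Module B V] {σ : B →+* B}

/-- The bi-additive map underlying a form `h` that is linear in the second variable and
`σ`-semilinear in the first one. -/
def biadd (h : V →ₛₗ[σ] V →ₗ[B] B) : V →+ V →+ B :=
  AddMonoidHom.mk' (fun u => (h u).toAddMonoidHom) (fun u v => by ext w; simp)

@[simp] lemma biadd_apply (h : V →ₛₗ[σ] V →ₗ[B] B) (u v : V) : biadd h u v = h u v := rfl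

/-- The unitary group of `h`: the `B`-linear automorphisms of `V` that preserve `h`. -/
def unitaryGroup (h : V →ₛₗ[σ] V →ₗ[B] B) : Subgroup (V ≃ₗ[B] V) where
  carrier := {g | ∀ u v, h (g u) (g v) = h u v}
  mul_mem' := fun {a b} ha hb u v => by
    simp only [LinearEquiv.mul_apply]
    rw [ha, hb]
  one_mem' := fun u v => rfl
  inv_mem' := fun {a} ha u v => by
    have h1 := ha (a⁻¹ u) (a⁻¹ v)
    have h2 : ∀ w, a (a⁻¹ w) = w := fun w => a.apply_symm_apply w
    rwa [h2, h2, eq_comm] at h1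

/-- The representation `W` of the unitary group of `h` is a Weil representation of type `ψ`: there
is a Schroedinger representation `S` of `H(h)` of type `ψ` on the same space such that
`W(g) S(k) W(g)⁻¹ = S(g k)` for all `g` and `k`. -/
def IsWeil (h : V →ₛₗ[σ] V →ₗ[B] B) (ψ : AddChar B ℂ) {X : Type*} [AddCommGroup X] [Module ℂ X]
    (W : Representation ℂ (unitaryGroup h) X) : Prop :=
  ∃ S : Representation ℂ (Heisenberg (biadd h)) X, IsSchroedinger (biadd h) ψ S ∧
    ∀ (g : unitaryGroup h) (k : Heisenberg (biadd h)) (F : X),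
      W g (S k F) = S (k.act g.1) (W g F)

/-- The congruence subgroup `U(I) = {g ∈ U | g v ≡ v mod I V for all v}`. -/
def congruenceSubgroup (h : V →ₛₗ[σ] V →ₗ[B] B) (I : Ideal B) : Subgroup (unitaryGroup h) where
  carrier := {g | ∀ v, g.1 v - v ∈ (I • ⊤ : Submodule B V)}
  mul_mem' := fun {a b} ha hb v => by
    have h1 := add_mem (ha (b.1 v)) (hb v)
    rwa [sub_add_sub_cancel] at h1
  one_mem' := fun v => by simp
  inv_mem' := fun {a} ha v => by
    have h1 := neg_mem (ha (a⁻¹.1 v))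
    have h2 : a.1 (a⁻¹.1 v) = v := a.1.apply_symm_apply v
    rwa [h2, neg_sub] at h1

lemma map_smul_top_le (g : V →ₗ[B] V) (I : Ideal B) :
    (I • ⊤ : Submodule B V) ≤ (I • ⊤ : Submodule B V).comap g := by
  rw [Submodule.smul_le]
  intro r hr n _
  rw [Submodule.mem_comap, map_smul]
  exact Submodule.smul_mem_smul hr trivial

lemma form_mem_right (h : V →ₛₗ[σ] V →ₗ[B] B) (I : Ideal B) (u : V) {v : V}
    (hv : v ∈ (I • ⊤ : Submodule B V)) : h u v ∈ I := by
  have : (I • ⊤ : Submodule B V) ≤ Submodule.comap (h u) I := by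
    rw [Submodule.smul_le]
    intro r hr n _
    rw [Submodule.mem_comap, map_smul]
    exact I.mul_mem_right _ hr
  exact this hv

lemma form_mem_left (h : V →ₛₗ[σ] V →ₗ[B] B) {I : Ideal B} (hI : I ≤ I.comap σ) (v : V) {u : V}
    (hu : u ∈ (I • ⊤ : Submodule B V)) : h u v ∈ I := by
  induction hu using Submodule.smul_induction_on' with
  | smul r hr n _ =>
    rw [map_smulₛₗ, LinearMap.smul_apply]
    exact I.mul_mem_right _ (hI hr)
  | add a _ b _ ha hb =>
    rw [map_add, LinearMap.add_apply]
    exact I.add_mem ha hb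

/-- The ring endomorphism of `B ⧸ I` induced by `σ`. -/
abbrev redEnd {I : Ideal B} (hI : I ≤ I.comap σ) : B ⧸ I →+* B ⧸ I := Ideal.quotientMap I σ hI

/-- The form on `V ⧸ I V` with values in `B ⧸ I` induced by `h`:
`(v + I V, w + I V) ↦ h(v, w) + I`. -/
def redForm (h : V →ₛₗ[σ] V →ₗ[B] B) {I : Ideal B} (hI : I ≤ I.comap σ) :
    (V ⧸ (I • ⊤ : Submodule B V)) →ₛₗ[redEnd hI] (V ⧸ (I • ⊤ : Submodule B V)) →ₗ[B ⧸ I] B ⧸ I :=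
  LinearMap.mk₂'ₛₗ (redEnd hI) (RingHom.id (B ⧸ I))
    (fun u v => Quotient.liftOn₂' u v (fun u v => Ideal.Quotient.mk I (h u v))
      (fun a₁ a₂ b₁ b₂ h₁ h₂ => by
        rw [Ideal.Quotient.eq]
        have e1 := (Submodule.quotientRel_def _).mp h₁
        have e2 := (Submodule.quotientRel_def _).mp h₂
        have e3 := I.add_mem (form_mem_left h hI a₂ e1) (form_mem_right h I b₁ e2)
        rw [map_sub, map_sub, LinearMap.sub_apply, sub_add_sub_cancel] at e3
        exact e3))
    (fun a b c => by
      induction a using Submodule.Quotient.induction_on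
      induction b using Submodule.Quotient.induction_on
      induction c using Submodule.Quotient.induction_on
      exact congrArg (Ideal.Quotient.mk I) (by simp))
    (fun r a c => by
      obtain ⟨r, rfl⟩ := Ideal.Quotient.mk_surjective r
      induction a using Submodule.Quotient.induction_on
      induction c using Submodule.Quotient.induction_on
      exact congrArg (Ideal.Quotient.mk I) (by rw [map_smulₛₗ]; rfl))
    (fun a b c => by
      induction a using Submodule.Quotient.induction_on
      induction b using Submodule.Quotient.induction_on
      induction c using Submodule.Quotient.induction_on
      exact congrArg (Ideal.Quotient.mk I) (by simp))
    (fun r a c => by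
      obtain ⟨r, rfl⟩ := Ideal.Quotient.mk_surjective r
      induction a using Submodule.Quotient.induction_on
      induction c using Submodule.Quotient.induction_on
      exact congrArg (Ideal.Quotient.mk I) (by rw [map_smul]; rfl))

@[simp] lemma redForm_mk (h : V →ₛₗ[σ] V →ₗ[B] B) {I : Ideal B} (hI : I ≤ I.comap σ) (u v : V) :
    redForm h hI (Submodule.Quotient.mk u) (Submodule.Quotient.mk v)
      = Ideal.Quotient.mk I (h u v) := rfl

/-- The `B ⧸ I`-linear automorphism `v + I V ↦ g v + I V` of `V ⧸ I V` induced by `g`. -/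
def redEquiv (I : Ideal B) (g : V ≃ₗ[B] V) :
    (V ⧸ (I • ⊤ : Submodule B V)) ≃ₗ[B ⧸ I] (V ⧸ (I • ⊤ : Submodule B V)) where
  toFun := Submodule.mapQ _ _ g.toLinearMap (map_smul_top_le g.toLinearMap I)
  invFun := Submodule.mapQ _ _ g.symm.toLinearMap (map_smul_top_le g.symm.toLinearMap I)
  map_add' := fun a b => map_add _ a b
  map_smul' := fun r a => by
    obtain ⟨r, rfl⟩ := Ideal.Quotient.mk_surjective r
    exact map_smul (Submodule.mapQ _ _ g.toLinearMap (map_smul_top_le g.toLinearMap I)) r a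
  left_inv := fun a => by
    induction a using Submodule.Quotient.induction_on
    simp
  right_inv := fun a => by
    induction a using Submodule.Quotient.induction_on
    simp

@[simp] lemma redEquiv_mk (I : Ideal B) (g : V ≃ₗ[B] V) (v : V) :
    redEquiv I g (Submodule.Quotient.mk v) = Submodule.Quotient.mk (g v) := rfl

/-- The natural homomorphism `g ↦ (v + I V ↦ g v + I V)` from the unitary group of `h` to the
unitary group of the induced form on `V ⧸ I V`. -/
def redHom (h : V →ₛₗ[σ] V →ₗ[B] B) {I : Ideal B} (hI : I ≤ I.comap σ) :
    unitaryGroup h →* unitaryGroup (redForm h hI) where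
  toFun g := ⟨redEquiv I g.1, fun u v => by
    induction u using Submodule.Quotient.induction_on
    induction v using Submodule.Quotient.induction_on
    simp only [redEquiv_mk, redForm_mk]
    rw [g.2]⟩
  map_one' := by
    ext a
    induction a using Submodule.Quotient.induction_on
    rfl
  map_mul' := fun g g' => by
    ext a
    induction a using Submodule.Quotient.induction_on
    rfl

/-! ### The induced module `X`

For an ideal `J` with `σ(J) J = 0` and an additive character `ψ` of `B` put `V₀ = J V`. Then
`(B, V₀)` is a subgroup of `H(h)` and `ρ(b, u) = ψ(b)` is a linear character of it. -/

/-- The module induced from the linear character `ρ` of `(B, V₀)` to `H(h)`, realised as the space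
of functions `F` on `H(h)` with `F(k s) = ρ(s)⁻¹ F(k)` for `s ∈ (B, V₀)`. -/
def inducedModule (h : V →ₛₗ[σ] V →ₗ[B] B) (J : Ideal B) (ψ : AddChar B ℂ) :
    Submodule ℂ (Heisenberg (biadd h) → ℂ) where
  carrier := {F | ∀ (k s : Heisenberg (biadd h)), s.vec ∈ (J • ⊤ : Submodule B V) →
    F (k * s) = (ψ s.center)⁻¹ * F k}
  zero_mem' := fun k s _ => by simp
  add_mem' := fun {F F'} hF hF' k s hs => by
    simp only [Pi.add_apply]
    rw [hF k s hs, hF' k s hs, mul_add]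
  smul_mem' := fun c F hF k s hs => by
    simp only [Pi.smul_apply, smul_eq_mul]
    rw [hF k s hs]
    ring

/-- The action of the Heisenberg group on the induced module, by left translation. -/
def heisenbergRep (h : V →ₛₗ[σ] V →ₗ[B] B) (J : Ideal B) (ψ : AddChar B ℂ) :
    Representation ℂ (Heisenberg (biadd h)) (inducedModule h J ψ) where
  toFun k₀ :=
    { toFun := fun F => ⟨fun k => F.1 (k₀⁻¹ * k), fun k s hs => by
        simpa only [mul_assoc] using F.2 (k₀⁻¹ * k) s hs⟩
      map_add' := fun _ _ => rfl
      map_smul' := fun _ _ => rfl }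
  map_one' := by
    ext F k
    simp
  map_mul' := fun a b => by
    ext F k
    simp [mul_assoc]

lemma act_mul {h : V →ₛₗ[σ] V →ₗ[B] B} (g : unitaryGroup h) (k l : Heisenberg (biadd h)) :
    (k * l).act g.1 = k.act g.1 * l.act g.1 := by
  ext
  · simp [g.2 k.vec l.vec]
  · simp

/-- The action of the unitary group `U` on the induced module, `(g F)(k) = F(g⁻¹ k)`; this is the
action obtained by extending `ρ` trivially on `U` to `(B, V₀) ⋊ U` and inducing to `H(h) ⋊ U`. -/
def weilRep (h : V →ₛₗ[σ] V →ₗ[B] B) (J : Ideal B) (ψ : AddChar B ℂ) :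
    Representation ℂ (unitaryGroup h) (inducedModule h J ψ) where
  toFun g :=
    { toFun := fun F => ⟨fun k => F.1 (k.act g⁻¹.1), fun k s hs => by
        have h1 := F.2 (k.act g⁻¹.1) (s.act g⁻¹.1) (map_smul_top_le (g⁻¹.1).toLinearMap J hs)
        rwa [← act_mul] at h1⟩
      map_add' := fun _ _ => rfl
      map_smul' := fun _ _ => rfl }
  map_one' := by
    ext F k
    rfl
  map_mul' := fun a b => by
    ext F k
    change F.1 _ = F.1 _
    rw [mul_inv_rev]
    rfl

/-- `W(g) S(k) W(g)⁻¹ = S(g k)` on the induced module. -/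
theorem weilRep_heisenbergRep (h : V →ₛₗ[σ] V →ₗ[B] B) (J : Ideal B) (ψ : AddChar B ℂ)
    (g : unitaryGroup h) (k : Heisenberg (biadd h)) (F : inducedModule h J ψ) :
    weilRep h J ψ g (heisenbergRep h J ψ k F)
      = heisenbergRep h J ψ (k.act g.1) (weilRep h J ψ g F) := by
  ext l
  change F.1 (k⁻¹ * l.act g⁻¹.1) = F.1 (((k.act g.1)⁻¹ * l).act g⁻¹.1)
  rw [act_mul]
  refine congrArg (fun t => F.1 (t * _)) ?_
  ext
  · simp [g.2 k.vec k.vec]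
  · simp

lemma form_eq_zero (h : V →ₛₗ[σ] V →ₗ[B] B) {J : Ideal B}
    (hJ : ∀ a ∈ J, ∀ b ∈ J, σ a * b = 0) {u v : V} (hu : u ∈ (J • ⊤ : Submodule B V))
    (hv : v ∈ (J • ⊤ : Submodule B V)) : h u v = 0 := by
  induction hu using Submodule.smul_induction_on' with
  | smul r hr n _ =>
    rw [map_smulₛₗ, LinearMap.smul_apply, smul_eq_mul]
    exact hJ r hr _ (form_mem_right h J n hv)
  | add a _ b _ ha hb => rw [map_add, LinearMap.add_apply, ha, hb, add_zero]

open Classical in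
/-- The generator `ζ` of the induced module: the function equal to `ρ⁻¹` on `(B, V₀)` and to zero
elsewhere. -/
def zetaVec (h : V →ₛₗ[σ] V →ₗ[B] B) {J : Ideal B} (hJ : ∀ a ∈ J, ∀ b ∈ J, σ a * b = 0)
    (ψ : AddChar B ℂ) : inducedModule h J ψ :=
  ⟨fun k => if k.vec ∈ (J • ⊤ : Submodule B V) then (ψ k.center)⁻¹ else 0, fun k s hs => by
    have e : (k * s).vec ∈ (J • ⊤ : Submodule B V) ↔ k.vec ∈ (J • ⊤ : Submodule B V) :=
      Submodule.add_mem_iff_left _ hs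
    by_cases hk : k.vec ∈ (J • ⊤ : Submodule B V)
    · simp only [if_pos hk, if_pos (e.mpr hk)]
      rw [Heisenberg.mul_center, biadd_apply, form_eq_zero h hJ hk hs, add_zero,
        AddChar.map_add_eq_mul, mul_inv, mul_comm]
    · simp only [if_neg hk, if_neg (fun hc => hk (e.mp hc)), mul_zero]⟩

/-- The vector `e_v = (0, v) ⊗ ζ` of the induced module. -/
def basisVec (h : V →ₛₗ[σ] V →ₗ[B] B) {J : Ideal B} (hJ : ∀ a ∈ J, ∀ b ∈ J, σ a * b = 0)
    (ψ : AddChar B ℂ) (v : V) : inducedModule h J ψ :=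
  heisenbergRep h J ψ ⟨0, v⟩ (zetaVec h hJ ψ)

open Classical in
lemma weilRep_zetaVec (h : V →ₛₗ[σ] V →ₗ[B] B) {J : Ideal B}
    (hJ : ∀ a ∈ J, ∀ b ∈ J, σ a * b = 0) (ψ : AddChar B ℂ) (g : unitaryGroup h) :
    weilRep h J ψ g (zetaVec h hJ ψ) = zetaVec h hJ ψ := by
  ext k
  have e : g⁻¹.1 k.vec ∈ (J • ⊤ : Submodule B V) ↔ k.vec ∈ (J • ⊤ : Submodule B V) := by
    refine ⟨fun hk => ?_, fun hk => map_smul_top_le (g⁻¹.1).toLinearMap J hk⟩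
    have h1 : g.1 (g⁻¹.1 k.vec) = k.vec := g.1.apply_symm_apply _
    rw [← h1]
    exact map_smul_top_le g.1.toLinearMap J hk
  exact if_congr e rfl rfl

lemma weilRep_basisVec (h : V →ₛₗ[σ] V →ₗ[B] B) {J : Ideal B}
    (hJ : ∀ a ∈ J, ∀ b ∈ J, σ a * b = 0) (ψ : AddChar B ℂ) (g : unitaryGroup h) (v : V) :
    weilRep h J ψ g (basisVec h hJ ψ v) = basisVec h hJ ψ (g.1 v) := by
  rw [basisVec, weilRep_heisenbergRep, weilRep_zetaVec]
  rfl

/-- The `U`-submodule spanned by all `e_v` with `v` in a `U`-stable subset `s` of `V`. -/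
def spanBasis (h : V →ₛₗ[σ] V →ₗ[B] B) {J : Ideal B} (hJ : ∀ a ∈ J, ∀ b ∈ J, σ a * b = 0)
    (ψ : AddChar B ℂ) (s : Set V) (hs : ∀ g : unitaryGroup h, ∀ v ∈ s, g.1 v ∈ s) :
    Subrepresentation (weilRep h J ψ) where
  toSubmodule := Submodule.span ℂ (basisVec h hJ ψ '' s)
  apply_mem_toSubmodule := fun g F hF => by
    have : Submodule.span ℂ (basisVec h hJ ψ '' s)
        ≤ (Submodule.span ℂ (basisVec h hJ ψ '' s)).comap (weilRep h J ψ g) := by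
      rw [Submodule.span_le]
      rintro _ ⟨v, hv, rfl⟩
      simp only [Submodule.comap_coe, Set.mem_preimage, SetLike.mem_coe]
      rw [weilRep_basisVec]
      exact Submodule.subset_span ⟨g.1 v, hs g v hv, rfl⟩
    exact this hF

end Sesquilinear

/-! ### The ramified quadratic extension `A = R[y]`, `y² = x` -/

section Ramified

variable {R : Type*} [CommRing R]

/-- `A = R[y] = R ⊕ R y` with `y² = x`. The involution `(r + s y)* = r - s y` is `star`. -/
abbrev Ext (x : R) : Type _ := QuadraticAlgebra R x 0

/-- The involution of `A` as a ring homomorphism. -/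
abbrev conj (x : R) : Ext x →+* Ext x := starRingEnd (Ext x)

/-- The element `y` of `A`. -/
abbrev yElt (x : R) : Ext x := QuadraticAlgebra.omega

/-- The ideal `yʲ A`. -/
def yIdeal (x : R) (j : ℕ) : Ideal (Ext x) := Ideal.span {yElt x ^ j}

/-- The `R`-linear map `d : A → R`, `d(r + s y) = 2 s`. -/
def dMap (x : R) : Ext x →ₗ[R] R := (2 : R) • QuadraticAlgebra.imₗ x 0

/-- The linear character `μ(a) = ψ(d(a))` of `A`. -/
def mu (x : R) (ψ : AddChar R ℂ) : AddChar (Ext x) ℂ := ψ.compAddMonoidHom (dMap x).toAddMonoidHom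

lemma conj_y (x : R) : conj x (yElt x) = -yElt x := by
  ext <;> simp [starRingEnd_apply]

lemma y_sq (x : R) : yElt x ^ 2 = algebraMap R (Ext x) x := by
  ext <;> simp [pow_two, QuadraticAlgebra.algebraMap_eq]

lemma yIdeal_le_comap (x : R) (j : ℕ) : yIdeal x j ≤ (yIdeal x j).comap (conj x) := by
  rw [yIdeal, Ideal.span_singleton_le_iff_mem, Ideal.mem_comap, map_pow, conj_y, neg_pow]
  exact Ideal.mul_mem_left _ _ (Ideal.mem_span_singleton_self _)

lemma y_pow_two_mul (x : R) {l : ℕ} (hx : x ^ l = 0) : yElt x ^ (2 * l) = 0 := by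
  rw [pow_mul, y_sq, ← map_pow, hx, map_zero]

lemma yIdeal_isotropic (x : R) {l : ℕ} (hx : x ^ l = 0) :
    ∀ a ∈ yIdeal x l, ∀ b ∈ yIdeal x l, conj x a * b = 0 := by
  intro a ha b hb
  obtain ⟨c, hc⟩ := Ideal.mem_span_singleton'.mp (yIdeal_le_comap x l ha)
  obtain ⟨d, hd⟩ := Ideal.mem_span_singleton'.mp hb
  rw [← hc, ← hd, mul_mul_mul_comm, ← pow_add, ← two_mul, y_pow_two_mul x hx, mul_zero]

/-- The linear character `a + y^(2(ℓ-1)) A ↦ μ(-y² a)` of `A / y^(2(ℓ-1)) A`. -/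
def muBar (x : R) {l : ℕ} (hx : x ^ l = 0) (hl : 1 < l) (ψ : AddChar R ℂ) :
    AddChar (Ext x ⧸ yIdeal x (2 * (l - 1))) ℂ :=
  AddChar.toAddMonoidHomEquiv.symm
    (QuotientAddGroup.lift (yIdeal x (2 * (l - 1))).toAddSubgroup
      ((mu x ψ).toAddMonoidHom.comp (AddMonoidHom.mulLeft (-yElt x ^ 2)))
      (fun a ha => by
        obtain ⟨c, rfl⟩ := Ideal.mem_span_singleton'.mp ha
        have e : -yElt x ^ 2 * (c * yElt x ^ (2 * (l - 1))) = 0 := by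
          have : 2 + 2 * (l - 1) = 2 * l := by omega
          rw [mul_left_comm, neg_mul, ← pow_add, this, y_pow_two_mul x hx, neg_zero, mul_zero]
        rw [AddMonoidHom.mem_ker, AddMonoidHom.comp_apply, AddMonoidHom.coe_mulLeft, e, map_zero]))

lemma muBar_mk (x : R) {l : ℕ} (hx : x ^ l = 0) (hl : 1 < l) (ψ : AddChar R ℂ) (a : Ext x) :
    muBar x hx hl ψ (Ideal.Quotient.mk _ a) = mu x ψ (-yElt x ^ 2 * a) := rfl

lemma x_pow_eq_zero [Finite R] [IsLocalRing R] {x : R} {l : ℕ}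
    (hx : Ideal.span {x} = IsLocalRing.maximalIdeal R)
    (hl : nilpotencyClass (IsLocalRing.maximalIdeal R) = l) : x ^ l = 0 := by
  have h1 : IsNilpotent (IsLocalRing.maximalIdeal R) := by
    have := IsArtinianRing.isNilpotent_jacobson_bot (R := R)
    rwa [IsLocalRing.jacobson_eq_maximalIdeal ⊥ bot_ne_top] at this
  have h2 := pow_nilpotencyClass h1
  rw [hl, ← hx, Ideal.span_singleton_pow, Ideal.zero_eq_bot, Ideal.span_singleton_eq_bot] at h2
  exact h2

variable {V : Type*} [AddCommGroup V] {x : R} [Module (Ext x) V]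

/-- The Weil module `X = ind Z`, where `V₀ = y^ℓ V`. -/
abbrev WeilModule (h : V →ₛₗ[conj x] V →ₗ[Ext x] Ext x) (l : ℕ) (ψ : AddChar R ℂ) : Type _ :=
  inducedModule h (yIdeal x l) (mu x ψ)

/-- The action of the unitary group `U` on the Weil module `X`. -/
abbrev weil (h : V →ₛₗ[conj x] V →ₗ[Ext x] Ext x) (l : ℕ) (ψ : AddChar R ℂ) :
    Representation ℂ (unitaryGroup h) (WeilModule h l ψ) :=
  weilRep h (yIdeal x l) (mu x ψ)

/-- A vector is primitive if it does not lie in `y V`. -/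
def IsPrimitiveVec (v : V) : Prop := v ∉ (yIdeal x 1 • ⊤ : Submodule (Ext x) V)

lemma isPrimitiveVec_iff (h : V →ₛₗ[conj x] V →ₗ[Ext x] Ext x) (g : unitaryGroup h) (v : V) :
    IsPrimitiveVec (x := x) (g.1 v) ↔ IsPrimitiveVec (x := x) v := by
  refine not_congr ⟨fun hv => ?_, fun hv => map_smul_top_le g.1.toLinearMap _ hv⟩
  have h1 := map_smul_top_le g.1.symm.toLinearMap _ hv
  simpa using h1

/-- `Top`: the `U`-submodule of `X` spanned by the `e_v` with `v` primitive. -/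
def Top (h : V →ₛₗ[conj x] V →ₗ[Ext x] Ext x) {l : ℕ} (hx : x ^ l = 0) (ψ : AddChar R ℂ) :
    Subrepresentation (weil h l ψ) :=
  spanBasis h (yIdeal_isotropic x hx) (mu x ψ) {v | IsPrimitiveVec (x := x) v}
    (fun g v hv => (isPrimitiveVec_iff h g v).mpr hv)

/-- `Bot`: the `U`-submodule of `X` spanned by the `e_v` with `v` not primitive. -/
def Bot (h : V →ₛₗ[conj x] V →ₗ[Ext x] Ext x) {l : ℕ} (hx : x ^ l = 0) (ψ : AddChar R ℂ) :
    Subrepresentation (weil h l ψ) :=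
  spanBasis h (yIdeal_isotropic x hx) (mu x ψ) {v | ¬ IsPrimitiveVec (x := x) v}
    (fun g v hv => (isPrimitiveVec_iff h g v).not.mpr hv)

/-- The congruence subgroup `U(yʲ)` of the unitary group `U` of `h`. -/
abbrev congrSubgroup (h : V →ₛₗ[conj x] V →ₗ[Ext x] Ext x) (j : ℕ) : Subgroup (unitaryGroup h) :=
  congruenceSubgroup h (yIdeal x j)

/-- The hermitian form on `V / y^(2(ℓ-1)) V` with values in `A / y^(2(ℓ-1)) A` induced by `h`. -/
abbrev hBar (h : V →ₛₗ[conj x] V →ₗ[Ext x] Ext x) (l : ℕ) :=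
  redForm h (yIdeal_le_comap x (2 * (l - 1)))

/-- The natural map `g ↦ (v + y^(2(ℓ-1)) V ↦ g v + y^(2(ℓ-1)) V)` from the unitary group of `h`
to the unitary group of the induced form. -/
abbrev toUBar (h : V →ₛₗ[conj x] V →ₗ[Ext x] Ext x) (l : ℕ) :
    unitaryGroup h →* unitaryGroup (hBar h l) :=
  redHom h (yIdeal_le_comap x (2 * (l - 1)))

end Ramified

end

end RamifiedWeil

namespace RamifiedWeil

/-! ### The finite chain ring `A = R[y]` -/

section Ring

variable {R : Type*} [CommRing R]

/-! `A` is a chain ring with uniformizer `y`: every non-unit is a multiple of `y`, `y ^ (2ℓ) = 0`,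
and the annihilator of `y ^ i` is `y ^ (2ℓ - i) A`. Since `V` is free and `h` non-degenerate, `h v`
takes values in `y ^ j A` only if `v ∈ y ^ j V` (`mem_smul_top_of_form_mem`).

For `z ∈ V₀` the vectors `e_v` and `e_{v+z}` differ by the scalar `μ(-h(v, z))` (`basisVec_add`). An
element of `U(y^(2(ℓ-1)))` moves `y w` by some `y^(2ℓ-1) u`, which lies in `V₀` and is orthogonal to
`y w`, so it fixes `e_{yw}`. If `v` is primitive, some `h(v, u)` equals `1`, and a transvection
along `u` with coefficient `r y^(2ℓ-1)` multiplies the value at `v` by `ψ(2 r x^(ℓ-1))`, which is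
not `1` for a suitable `r`. Hence a fixed vector of `Top` vanishes.

A unitary map of the reduction lifts to a linear map `T`; composing with `1 + E`, where `E` is minus
half the adjoint of the error, makes it an isometry (`toUBar_surjective`). The dilation `(b, v) ↦
(-y² b, y v)` of `H(h)` turns `Bot` into a representation of `H(h)` that factors through the reduced
Heisenberg group. It is irreducible because `V₀` is its own orthogonal space for the commutator
pairing: averaging over `V₀` extracts `ζ` from any non-zero submodule, and `ζ` generates `Bot`. -/

lemma isUnit_two_of_odd_ringChar [Finite R] [IsLocalRing R] (hodd : Odd (ringChar R)) :
    IsUnit (2 : R) := by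
  by_contra h2
  have h1 : IsNilpotent (IsLocalRing.maximalIdeal R) := by
    have := IsArtinianRing.isNilpotent_jacobson_bot (R := R)
    rwa [IsLocalRing.jacobson_eq_maximalIdeal ⊥ bot_ne_top] at this
  obtain ⟨n, hn⟩ := h1
  have hm : (2 : R) ∈ IsLocalRing.maximalIdeal R := (IsLocalRing.mem_maximalIdeal 2).mpr h2
  have h3 : (2 : R) ^ n = 0 := by
    have := Ideal.pow_mem_pow hm n
    rwa [hn] at this
  -- A nilpotent `2` would make the odd characteristic divide a power of `2`.
  have h4 : ringChar R ∣ 2 ^ n := (ringChar.spec R (2 ^ n)).mp (by exact_mod_cast h3)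
  have h5 : ringChar R = 1 :=
    (hodd.coprime_two_right.pow_right n).eq_one_of_dvd h4
  exact CharP.ringChar_ne_one h5

lemma pow_pred_ne_zero [IsLocalRing R] {x : R}
    (hx : Ideal.span {x} = IsLocalRing.maximalIdeal R) {l : ℕ}
    (hl : nilpotencyClass (IsLocalRing.maximalIdeal R) = l) (hl0 : 0 < l) : x ^ (l - 1) ≠ 0 := by
  intro h0
  have h1 : IsLocalRing.maximalIdeal R ^ (l - 1) = 0 := by
    rw [← hx, Ideal.span_singleton_pow, h0, Ideal.zero_eq_bot, Ideal.span_singleton_eq_bot]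
  have h2 : nilpotencyClass (IsLocalRing.maximalIdeal R) ≤ l - 1 := Nat.sInf_le h1
  omega

lemma mem_yIdeal {x : R} {j : ℕ} {a : Ext x} : a ∈ yIdeal x j ↔ ∃ b, a = yElt x ^ j * b := by
  rw [yIdeal, Ideal.mem_span_singleton]
  rfl

/-- The norm `r² - x s²` of `r + s y` is a unit as soon as `r` is; otherwise `r = x c = y² c`, and
`y` factors out. -/
lemma isUnit_or_exists_eq_y_mul [IsLocalRing R] {x : R}
    (hx : Ideal.span {x} = IsLocalRing.maximalIdeal R) (a : Ext x) :
    IsUnit a ∨ ∃ b, a = yElt x * b := by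
  have hxm : x ∈ IsLocalRing.maximalIdeal R := hx ▸ Ideal.mem_span_singleton_self x
  by_cases hr : a.re ∈ IsLocalRing.maximalIdeal R
  · right
    rw [← hx, Ideal.mem_span_singleton] at hr
    obtain ⟨c, hc⟩ := hr
    exact ⟨⟨a.im, c⟩, by ext <;> simp [hc]⟩
  · left
    rw [QuadraticAlgebra.isUnit_iff_norm_isUnit]
    by_contra hn
    rw [← mem_nonunits_iff, ← IsLocalRing.mem_maximalIdeal, QuadraticAlgebra.norm_def] at hn
    have h1 : a.re * a.re ∈ IsLocalRing.maximalIdeal R := by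
      have := add_mem hn (Ideal.mul_mem_right (a.im * a.im) _ hxm)
      convert this using 1
      ring
    exact hr (((IsLocalRing.maximalIdeal.isMaximal R).isPrime.mem_or_mem h1).elim id id)

lemma y_pow_ne_zero {x : R} {l : ℕ} (hl0 : 0 < l) (hx : x ^ (l - 1) ≠ 0) :
    yElt x ^ (2 * l - 1) ≠ 0 := by
  have e : 2 * l - 1 = 2 * (l - 1) + 1 := by omega
  rw [e, pow_succ, pow_mul, y_sq, ← map_pow]
  intro h0
  have := congrArg QuadraticAlgebra.im h0
  rw [QuadraticAlgebra.im_mul] at this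
  simp only [QuadraticAlgebra.algebraMap_re, QuadraticAlgebra.algebraMap_im,
    QuadraticAlgebra.omega_im, QuadraticAlgebra.im_zero] at this
  exact hx (by simpa using this)

/-- In `A`, the annihilator of `yⁱ` is `yʲ A` when `i + j = 2ℓ`. -/
lemma mem_yIdeal_of_y_pow_mul_eq_zero [IsLocalRing R] {x : R}
    (hx : Ideal.span {x} = IsLocalRing.maximalIdeal R) {l : ℕ} (hl0 : 0 < l)
    (hxl : x ^ (l - 1) ≠ 0) {i j : ℕ} (hij : i + j = 2 * l) {a : Ext x}
    (ha : yElt x ^ i * a = 0) : a ∈ yIdeal x j := by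
  induction j generalizing i with
  | zero => exact mem_yIdeal.mpr ⟨a, by simp⟩
  | succ j ih =>
    -- By induction `a = y ^ j b`, and the hypothesis becomes `y ^ (2ℓ-1) b = 0`; so `b` is not a
    -- unit and supplies one more factor `y`.
    obtain ⟨b, rfl⟩ := mem_yIdeal.mp
      (ih (i := i + 1) (by omega) (by rw [pow_succ', mul_assoc, ha, mul_zero]))
    have e : i + j = 2 * l - 1 := by omega
    rw [← mul_assoc, ← pow_add, e] at ha
    rcases isUnit_or_exists_eq_y_mul hx b with hb | ⟨c, rfl⟩
    · exact absurd ((hb.mul_left_eq_zero).mp ha) (y_pow_ne_zero hl0 hxl)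
    · exact mem_yIdeal.mpr ⟨c, by ring⟩

lemma mu_apply (x : R) (ψ : AddChar R ℂ) (a : Ext x) : mu x ψ a = ψ (2 * a.im) := rfl

/-- Only the `y`-coordinate is seen by `d`, but multiplying by multiples of `y` moves the other
coordinate there; hence the kernel of `μ` contains no non-zero ideal. -/
lemma exists_mu_mul_ne_one {x : R} (h2 : IsUnit (2 : R)) {ψ : AddChar R ℂ} (hψ : ψ.IsPrimitive)
    {a : Ext x} (ha : a ≠ 0) : ∃ b, mu x ψ (a * b) ≠ 1 := by
  have key : ∀ c : R, c ≠ 0 → ∃ d, ψ (2 * (c * d)) ≠ 1 := by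
    intro c hc
    obtain ⟨d, hd⟩ := AddChar.ne_one_iff.mp
      (hψ (a := 2 * c) (fun h0 => hc (h2.mul_right_eq_zero.mp h0)))
    exact ⟨d, by rwa [AddChar.mulShift_apply, mul_assoc] at hd⟩
  by_cases him : a.im = 0
  · have hre : a.re ≠ 0 := fun hre => ha (QuadraticAlgebra.ext hre him)
    obtain ⟨d, hd⟩ := key _ hre
    exact ⟨⟨0, d⟩, by simpa [mu_apply, him] using hd⟩
  · obtain ⟨d, hd⟩ := key _ him
    exact ⟨⟨d, 0⟩, by simpa [mu_apply] using hd⟩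

lemma conj_y_pow (x : R) (n : ℕ) : conj x (yElt x ^ n) = (-1) ^ n * yElt x ^ n := by
  rw [map_pow, conj_y, neg_pow]

end Ring

/-! ### Free modules over `A` and their hermitian forms -/

section Form

variable {R : Type*} [CommRing R] {x : R} {V : Type*} [AddCommGroup V] [Module (Ext x) V]

lemma mem_yIdeal_smul_top {j : ℕ} {v : V} :
    v ∈ (yIdeal x j • ⊤ : Submodule (Ext x) V) ↔ ∃ w, v = yElt x ^ j • w := by
  rw [yIdeal, Submodule.ideal_span_singleton_smul, Submodule.mem_smul_pointwise_iff_exists]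
  exact ⟨fun ⟨w, _, hw⟩ => ⟨w, hw.symm⟩, fun ⟨w, hw⟩ => ⟨w, trivial, hw.symm⟩⟩

lemma mem_smul_top_of_y_pow_smul_eq_zero [Module.Free (Ext x) V] [IsLocalRing R]
    (hx : Ideal.span {x} = IsLocalRing.maximalIdeal R) {l : ℕ} (hl0 : 0 < l)
    (hxl : x ^ (l - 1) ≠ 0) {i j : ℕ} (hij : i + j = 2 * l) {v : V}
    (hv : yElt x ^ i • v = 0) : v ∈ (yIdeal x j • ⊤ : Submodule (Ext x) V) := by
  let b := Module.Free.chooseBasis (Ext x) V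
  rw [← b.linearCombination_repr v, Finsupp.linearCombination_apply]
  refine Submodule.sum_mem _ fun k _ => Submodule.smul_mem_smul ?_ trivial
  refine mem_yIdeal_of_y_pow_mul_eq_zero hx hl0 hxl hij ?_
  have := congrArg (fun w => b.repr w k) hv
  simpa using this

variable {h : V →ₛₗ[conj x] V →ₗ[Ext x] Ext x}

/-- The functional `h (y ^ i v)` vanishes because `y ^ (i + j) = 0`, so injectivity gives `y ^ i v =
0`; freeness then transfers the annihilator statement from `A` to `V`. -/
lemma mem_smul_top_of_form_mem [Module.Free (Ext x) V] [IsLocalRing R]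
    (hx : Ideal.span {x} = IsLocalRing.maximalIdeal R) {l : ℕ} (hl0 : 0 < l)
    (hx0 : x ^ l = 0) (hxl : x ^ (l - 1) ≠ 0) (hinj : Function.Injective h) {i j : ℕ}
    (hij : i + j = 2 * l) {v : V} (hv : ∀ w, h v w ∈ yIdeal x j) :
    v ∈ (yIdeal x j • ⊤ : Submodule (Ext x) V) := by
  refine mem_smul_top_of_y_pow_smul_eq_zero hx hl0 hxl hij (hinj ?_)
  ext1 w
  obtain ⟨b, hb⟩ := mem_yIdeal.mp (hv w)
  rw [map_smulₛₗ, LinearMap.smul_apply, hb, conj_y_pow, map_zero, LinearMap.zero_apply,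
    smul_eq_mul, mul_assoc, ← mul_assoc (yElt x ^ i), ← pow_add, hij, y_pow_two_mul x hx0,
    zero_mul, mul_zero]

lemma form_y_pow_smul_left (n : ℕ) (u v : V) :
    h (yElt x ^ n • u) v = (-1) ^ n * yElt x ^ n * h u v := by
  rw [map_smulₛₗ, LinearMap.smul_apply, conj_y_pow, smul_eq_mul]

lemma form_y_pow_smul_y_pow_smul {l : ℕ} (hx0 : x ^ l = 0) {i j : ℕ} (hij : 2 * l ≤ i + j)
    (u v : V) : h (yElt x ^ i • u) (yElt x ^ j • v) = 0 := by
  have e : yElt x ^ i * yElt x ^ j = 0 := by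
    rw [← pow_add]
    exact pow_eq_zero_of_le hij (y_pow_two_mul x hx0)
  rw [form_y_pow_smul_left, map_smul, smul_eq_mul, mul_assoc, ← mul_assoc (yElt x ^ i), e,
    zero_mul, mul_zero]

/-- A linear isometry of a non-degenerate form on a finite module belongs to its unitary group. -/
lemma exists_unitary_eq [Finite V] (hinj : Function.Injective h) (T : V →ₗ[Ext x] V)
    (hT : ∀ u v, h (T u) (T v) = h u v) : ∃ g : unitaryGroup h, ∀ v, g.1 v = T v := by
  have h1 : Function.Injective T := by
    refine (injective_iff_map_eq_zero T).mpr fun v hv => hinj ?_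
    ext1 w
    rw [← hT, hv, map_zero]
    rfl
  exact ⟨⟨LinearEquiv.ofBijective T (Finite.injective_iff_bijective.mp h1), hT⟩, fun _ => rfl⟩

/-- The two linear terms cancel because `y ^ (2ℓ-1)` is skew under the involution, `r` is fixed by
it and `h` is hermitian. The quadratic term contains the square of `y ^ (2ℓ-1)`, which is zero. -/
lemma exists_transvection [Finite V] {l : ℕ} (hl0 : 0 < l) (hx0 : x ^ l = 0)
    (hinj : Function.Injective h) (hherm : ∀ u v, h v u = star (h u v)) (r : R) (u : V) :
    ∃ g : unitaryGroup h, ∀ w,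
      g.1 w = w + yElt x ^ (2 * l - 1) • (algebraMap R (Ext x) r * h u w) • u := by
  set n := 2 * l - 1 with hn
  have hodd : Odd n := ⟨l - 1, by omega⟩
  refine exists_unitary_eq hinj
    (LinearMap.id + yElt x ^ n • algebraMap R (Ext x) r • (h u).smulRight u) ?_ |>.imp
      fun g hg w => ?_
  · intro v w
    have hr : conj x (algebraMap R (Ext x) r) = algebraMap R (Ext x) r := by
      ext <;> simp [starRingEnd_apply]
    simp only [LinearMap.add_apply, LinearMap.id_apply, LinearMap.smul_apply,
      LinearMap.smulRight_apply, map_add]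
    rw [form_y_pow_smul_y_pow_smul hx0 (by omega), form_y_pow_smul_left]
    simp only [map_smul, map_smulₛₗ, LinearMap.smul_apply, smul_eq_mul, hr, hodd.neg_one_pow]
    rw [starRingEnd_apply, ← hherm u v]
    ring
  · rw [hg]
    simp [mul_smul]

end Form

/-! ### Reduction of the form modulo an ideal -/

section Reduction

variable {B V : Type*} [CommRing B] [AddCommGroup V] [Module B V] {σ : B →+* B}

lemma ker_redHom (h : V →ₛₗ[σ] V →ₗ[B] B) {I : Ideal B} (hI : I ≤ I.comap σ) :
    (redHom h hI).ker = congruenceSubgroup h I := by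
  ext g
  rw [MonoidHom.mem_ker]
  constructor
  · intro hg v
    have h1 : redEquiv I g.1 (Submodule.Quotient.mk v) = Submodule.Quotient.mk v :=
      congrArg (fun k : unitaryGroup (redForm h hI) => k.1 (Submodule.Quotient.mk v)) hg
    exact (Submodule.Quotient.eq _).mp h1
  · intro hg
    refine Subtype.ext (LinearEquiv.ext fun v => ?_)
    induction v using Submodule.Quotient.induction_on with
    | H v => exact (Submodule.Quotient.eq _).mpr (hg v)

/-- An additive isometry of a sesquilinear form with trivial left radical is linear. -/
lemma exists_unitary_eq_of_mem_isometryGroup {h : V →ₛₗ[σ] V →ₗ[B] B}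
    (hinj : Function.Injective h) {g : V ≃+ V} (hg : g ∈ isometryGroup (biadd h)) :
    ∃ k : unitaryGroup h, ∀ v, k.1 v = g v := by
  have hg' : ∀ u v, h (g u) (g v) = h u v := hg
  refine ⟨⟨{ g with map_smul' := fun a v => hinj ?_ }, hg⟩, fun _ => rfl⟩
  ext1 w
  -- Both sides are tested against the vectors `g w`, which exhaust `V`.
  obtain ⟨w, rfl⟩ := g.surjective w
  change h (g (a • v)) (g w) = h (a • g v) (g w)
  rw [hg', map_smulₛₗ, map_smulₛₗ, LinearMap.smul_apply, LinearMap.smul_apply, hg']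

/-- A unitary automorphism of the reduction lifts to an endomorphism of a projective module. -/
lemma exists_lift [Module.Projective B V] (I : Ideal B)
    (f : (V ⧸ (I • ⊤ : Submodule B V)) →ₗ[B ⧸ I] (V ⧸ (I • ⊤ : Submodule B V))) :
    ∃ T : V →ₗ[B] V, ∀ v, (Submodule.Quotient.mk (T v) : V ⧸ (I • ⊤ : Submodule B V))
      = f (Submodule.Quotient.mk v) := by
  let f' : V →ₗ[B] (V ⧸ (I • ⊤ : Submodule B V)) :=
    { toFun := fun v => f (Submodule.Quotient.mk v)
      map_add' := fun u v => by rw [Submodule.Quotient.mk_add, map_add]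
      map_smul' := fun a v => by
        change f (Ideal.Quotient.mk I a • Submodule.Quotient.mk v) = _
        rw [map_smul]
        rfl }
  obtain ⟨T, hT⟩ := Module.projective_lifting_property (Submodule.mkQ (I • ⊤ : Submodule B V)) f'
    (Submodule.mkQ_surjective _)
  exact ⟨T, fun v => LinearMap.congr_fun hT v⟩

end Reduction

/-! ### Lifting unitary maps modulo `y^(2(ℓ-1))`; non-degeneracy and primitivity after reduction. -/

section Ramified

variable {R : Type*} [CommRing R] {x : R} {V : Type*} [AddCommGroup V] [Module (Ext x) V]
  {h : V →ₛₗ[conj x] V →ₗ[Ext x] Ext x}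

/-- Every unitary automorphism of the reduction modulo `y^(2(ℓ-1))` lifts. -/
lemma toUBar_surjective [Finite V] [Module.Free (Ext x) V] [IsLocalRing R]
    (h2 : IsUnit (2 : R)) (hx : Ideal.span {x} = IsLocalRing.maximalIdeal R) {l : ℕ} (hl : 1 < l)
    (hx0 : x ^ l = 0) (hxl : x ^ (l - 1) ≠ 0) (hbij : Function.Bijective h)
    (hherm : ∀ u v, h v u = star (h u v)) : Function.Surjective (toUBar h l) := by
  intro gbar
  set n := 2 * (l - 1) with hn
  have hev : Even n := even_two_mul _
  obtain ⟨T, hT⟩ := exists_lift (yIdeal x n) gbar.1.toLinearMap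
  -- `K` measures the failure of the lift `T` to be an isometry; it is hermitian with values in `y ^
  -- n A`.
  let K : V → V →ₗ[Ext x] Ext x := fun v => (h (T v)).comp T - h v
  have hK : ∀ u v, K u v = h (T u) (T v) - h u v := fun _ _ => rfl
  have hKadd : ∀ u v, K (u + v) = K u + K v := fun u v => by
    ext1 w
    simp only [LinearMap.add_apply, hK, map_add]
    ring
  have hKsmul : ∀ (a : Ext x) v, K (a • v) = conj x a • K v := fun a v => by
    ext1 w
    simp only [LinearMap.smul_apply, hK, map_smul, map_smulₛₗ, smul_eq_mul]
    ring
  have hKherm : ∀ u v, K v u = star (K u v) := fun u v => by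
    rw [hK, hK, star_sub, ← hherm, ← hherm]
  have hKmem : ∀ u v, K u v ∈ yIdeal x n := fun u v => by
    have h1 := gbar.2 (Submodule.Quotient.mk u) (Submodule.Quotient.mk v)
    have e : ∀ w, gbar.1 (Submodule.Quotient.mk w) = Submodule.Quotient.mk (T w) :=
      fun w => (hT w).symm
    rw [e, e, redForm_mk, redForm_mk, Ideal.Quotient.eq] at h1
    exact h1
  obtain ⟨c, hc⟩ := h2.exists_right_inv
  set c' : Ext x := algebraMap R (Ext x) c with hc'
  have hcc : 2 * c' = 1 := by
    rw [hc', ← map_ofNat (algebraMap R (Ext x)), ← map_mul, hc, map_one]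
  have hcstar : conj x c' = c' := by ext <;> simp [hc', starRingEnd_apply]
  -- Non-degeneracy represents minus half of `K` as `h (E u) v`; the two first-order terms in `E`
  -- then cancel `K`.
  choose E₀ hE₀ using fun v => hbij.2 (-c' • K v)
  let E : V →ₗ[Ext x] V :=
    { toFun := E₀
      map_add' := fun u v => hbij.1 (by rw [map_add, hE₀, hE₀, hE₀, hKadd, smul_add])
      map_smul' := fun a v => hbij.1 (by
        rw [RingHom.id_apply, map_smulₛₗ, hE₀, hE₀, hKsmul, smul_comm]) }
  have hE : ∀ u v, h (E u) v = -c' * K u v := fun u v => by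
    change h (E₀ u) v = _
    rw [hE₀]
    rfl
  have hE' : ∀ u v, h u (E v) = -c' * K u v := fun u v => by
    rw [hherm (E v) u, hE, star_mul', ← hKherm v u, star_neg, ← starRingEnd_apply (R := Ext x),
      hcstar]
  have hEmem : ∀ v, ∃ w, E v = yElt x ^ n • w := fun v =>
    mem_yIdeal_smul_top.mp (mem_smul_top_of_form_mem hx (by omega) hx0 hxl hbij.1
      (i := 2) (by omega) fun w => by
        rw [hE]
        exact Ideal.mul_mem_left _ _ (hKmem v w))
  -- `E` and `K` both carry a factor `y ^ n`, and `2 n ≥ 2 ℓ` because `ℓ > 1`; all second-order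
  -- terms disappear.
  have hKE : ∀ u v, K (E u) v = 0 := fun u v => by
    obtain ⟨w, hw⟩ := hEmem u
    obtain ⟨b, hb⟩ := mem_yIdeal.mp (hKmem w v)
    have e : yElt x ^ n * yElt x ^ n = 0 := by
      rw [← pow_add]
      exact pow_eq_zero_of_le (by omega) (y_pow_two_mul x hx0)
    rw [hw, hKsmul, LinearMap.smul_apply, conj_y_pow, hb, smul_eq_mul, mul_assoc,
      ← mul_assoc (yElt x ^ n), e, zero_mul, mul_zero]
  have hKE' : ∀ u v, K v (E u) = 0 := fun u v => by rw [hKherm, hKE, star_zero]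
  have hTE : ∀ u v, h (T (E u)) (T v) = -c' * K u v := fun u v => by
    rw [← hE, ← sub_eq_zero, ← hK, hKE]
  have hTE' : ∀ u v, h (T u) (T (E v)) = -c' * K u v := fun u v => by
    rw [← hE', ← sub_eq_zero, ← hK, hKE']
  obtain ⟨g, hg⟩ := exists_unitary_eq hbij.1 (T + T.comp E) fun u v => by
    simp only [LinearMap.add_apply, LinearMap.comp_apply, map_add]
    rw [hTE, hTE', hTE, hKE']
    have := hK u v
    linear_combination -this - K u v * hcc
  refine ⟨g, Subtype.ext (LinearEquiv.ext fun v => ?_)⟩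
  induction v using Submodule.Quotient.induction_on with
  | H v =>
    refine Eq.trans ?_ (hT v)
    change Submodule.Quotient.mk (g.1 v) = _
    rw [Submodule.Quotient.eq, hg, LinearMap.add_apply, add_sub_cancel_left, LinearMap.comp_apply]
    obtain ⟨w, hw⟩ := hEmem v
    exact mem_yIdeal_smul_top.mpr ⟨T w, by rw [hw, map_smul]⟩

lemma hBar_injective [Module.Free (Ext x) V] [IsLocalRing R]
    (hx : Ideal.span {x} = IsLocalRing.maximalIdeal R) {l : ℕ} (hl0 : 0 < l)
    (hx0 : x ^ l = 0) (hxl : x ^ (l - 1) ≠ 0) (hinj : Function.Injective h) :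
    Function.Injective (hBar h l) := by
  refine (injective_iff_map_eq_zero _).mpr fun v hv => ?_
  induction v using Submodule.Quotient.induction_on with
  | H v =>
    rw [Submodule.Quotient.mk_eq_zero]
    refine mem_smul_top_of_form_mem hx hl0 hx0 hxl hinj (i := 2) (by omega) fun w => ?_
    have := LinearMap.congr_fun hv (Submodule.Quotient.mk w)
    rw [redForm_mk] at this
    exact Ideal.Quotient.eq_zero_iff_mem.mp this

/-- Multiplication by `-y²` has kernel `y^(2(ℓ-1)) A`, so it sends a non-zero class to a non-zero
element of `A`, whose multiples `μ` detects. -/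
lemma muBar_isPrimitive [IsLocalRing R] (h2 : IsUnit (2 : R))
    (hx : Ideal.span {x} = IsLocalRing.maximalIdeal R) {l : ℕ} (hl : 1 < l)
    (hx0 : x ^ l = 0) (hxl : x ^ (l - 1) ≠ 0) {ψ : AddChar R ℂ} (hψ : ψ.IsPrimitive) :
    (muBar x hx0 hl ψ).IsPrimitive := by
  intro a ha
  obtain ⟨a, rfl⟩ := Ideal.Quotient.mk_surjective a
  have h1 : -yElt x ^ 2 * a ≠ 0 := fun h0 => ha <| Ideal.Quotient.eq_zero_iff_mem.mpr <|
    mem_yIdeal_of_y_pow_mul_eq_zero hx (by omega) hxl (i := 2) (by omega)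
      (by rwa [neg_mul, neg_eq_zero] at h0)
  obtain ⟨b, hb⟩ := exists_mu_mul_ne_one h2 hψ h1
  refine AddChar.ne_one_iff.mpr ⟨Ideal.Quotient.mk _ b, ?_⟩
  rwa [AddChar.mulShift_apply, ← map_mul, muBar_mk, ← mul_assoc]

end Ramified

/-! ### The induced module -/

section Induced

variable {B V : Type*} [CommRing B] [AddCommGroup V] [Module B V] {σ : B →+* B}
  {h : V →ₛₗ[σ] V →ₗ[B] B} {J : Ideal B} {ψ : AddChar B ℂ}

lemma heisenbergRep_apply (k₀ : Heisenberg (biadd h)) (F : inducedModule h J ψ)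
    (k : Heisenberg (biadd h)) : (heisenbergRep h J ψ k₀ F).1 k = F.1 (k₀⁻¹ * k) := rfl

lemma inducedModule_apply_eq (F : inducedModule h J ψ) (b : B) (v : V) :
    F.1 ⟨b, v⟩ = (ψ b)⁻¹ * F.1 ⟨0, v⟩ := by
  have h1 := F.2 ⟨0, v⟩ ⟨b, 0⟩ (zero_mem _)
  rw [← h1]
  refine congrArg F.1 ?_
  ext <;> simp

lemma inducedModule_apply_add (F : inducedModule h J ψ) (b : B) (v : V) {z : V}
    (hz : z ∈ (J • ⊤ : Submodule B V)) : F.1 ⟨b, v + z⟩ = ψ (h v z) * F.1 ⟨b, v⟩ := by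
  have h1 := F.2 ⟨b, v⟩ ⟨-h v z, z⟩ hz
  rw [AddChar.map_neg_eq_inv, inv_inv] at h1
  rw [← h1]
  refine congrArg F.1 ?_
  ext <;> simp

lemma heisenbergRep_central (b : B) (F : inducedModule h J ψ) :
    heisenbergRep h J ψ ⟨b, 0⟩ F = ψ b • F := by
  ext k
  have e : (⟨b, 0⟩ : Heisenberg (biadd h))⁻¹ * k = k * ⟨-b, 0⟩ := by
    ext <;> simp [add_comm]
  rw [heisenbergRep_apply, e, F.2 _ _ (zero_mem _), AddChar.map_neg_eq_inv, inv_inv]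
  rfl

/-- Left translation by `z` is right translation by `z` up to a commutator, so `V₀` acts on
functions through multiplication by characters. -/
lemma heisenbergRep_apply_of_mem (hJ : ∀ a ∈ J, ∀ b ∈ J, σ a * b = 0)
    (F : inducedModule h J ψ) {z : V}
    (hz : z ∈ (J • ⊤ : Submodule B V)) (k : Heisenberg (biadd h)) :
    (heisenbergRep h J ψ ⟨0, z⟩ F).1 k = ψ (h z k.vec - h k.vec z) * F.1 k := by
  have e : (⟨0, z⟩ : Heisenberg (biadd h))⁻¹ * k = k * ⟨h k.vec z - h z k.vec, -z⟩ := by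
    ext
    · simp [form_eq_zero h hJ hz hz]
      abel
    · simp [add_comm]
  rw [heisenbergRep_apply, e, F.2 _ _ (neg_mem hz), ← neg_sub (h k.vec z), AddChar.map_neg_eq_inv]

lemma zetaVec_apply_zero (hJ : ∀ a ∈ J, ∀ b ∈ J, σ a * b = 0) :
    (zetaVec h hJ ψ).1 ⟨0, 0⟩ = 1 := by
  simp [zetaVec]

lemma zetaVec_apply_of_notMem (hJ : ∀ a ∈ J, ∀ b ∈ J, σ a * b = 0) {k : Heisenberg (biadd h)}
    (hk : k.vec ∉ (J • ⊤ : Submodule B V)) : (zetaVec h hJ ψ).1 k = 0 := if_neg hk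

/-- An element of the induced module supported on `(B, V₀)` is a multiple of `ζ`. -/
lemma eq_smul_zetaVec (hJ : ∀ a ∈ J, ∀ b ∈ J, σ a * b = 0) (F : inducedModule h J ψ)
    (hF : ∀ k : Heisenberg (biadd h), k.vec ∉ (J • ⊤ : Submodule B V) → F.1 k = 0) :
    F = F.1 ⟨0, 0⟩ • zetaVec h hJ ψ := by
  ext k
  change F.1 k = F.1 ⟨0, 0⟩ * (zetaVec h hJ ψ).1 k
  by_cases hk : k.vec ∈ (J • ⊤ : Submodule B V)
  · have e : k = ⟨0, 0⟩ * k := by ext <;> simp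
    rw [e, F.2 _ _ hk, (zetaVec h hJ ψ).2 _ _ hk, zetaVec_apply_zero, mul_one, mul_comm]
  · rw [hF k hk, zetaVec_apply_of_notMem hJ hk, mul_zero]

lemma heisenbergRep_zetaVec (hJ : ∀ a ∈ J, ∀ b ∈ J, σ a * b = 0)
    {b : B} {z : V} (hz : z ∈ (J • ⊤ : Submodule B V)) :
    heisenbergRep h J ψ ⟨b, z⟩ (zetaVec h hJ ψ) = ψ b • zetaVec h hJ ψ := by
  have e : (⟨b, z⟩ : Heisenberg (biadd h)) = ⟨b, 0⟩ * ⟨0, z⟩ := by ext <;> simp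
  rw [e, map_mul, Module.End.mul_apply, heisenbergRep_central]
  congr 1
  rw [eq_smul_zetaVec hJ (heisenbergRep h J ψ ⟨0, z⟩ (zetaVec h hJ ψ)) fun k hk => by
    rw [heisenbergRep_apply_of_mem hJ _ hz, zetaVec_apply_of_notMem hJ hk, mul_zero],
    heisenbergRep_apply_of_mem hJ _ hz]
  simp [zetaVec_apply_zero]

lemma heisenbergRep_basisVec (hJ : ∀ a ∈ J, ∀ b ∈ J, σ a * b = 0)
    (k : Heisenberg (biadd h)) (v : V) :
    heisenbergRep h J ψ k (basisVec h hJ ψ v)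
      = ψ (k.center + h k.vec v) • basisVec h hJ ψ (k.vec + v) := by
  have e : k * ⟨0, v⟩ = ⟨k.center + h k.vec v, 0⟩ * ⟨0, k.vec + v⟩ := by ext <;> simp
  rw [basisVec, ← Module.End.mul_apply, ← map_mul, e, map_mul, Module.End.mul_apply,
    heisenbergRep_central]
  rfl

/-- This scalar is what separates `Bot` from `Top`: under the congruence subgroup it is always `1`
on `y V` but not on primitive vectors. -/
lemma basisVec_add (hJ : ∀ a ∈ J, ∀ b ∈ J, σ a * b = 0)
    (v : V) {z : V} (hz : z ∈ (J • ⊤ : Submodule B V)) :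
    basisVec h hJ ψ (v + z) = ψ (-h v z) • basisVec h hJ ψ v := by
  have e : (⟨0, v + z⟩ : Heisenberg (biadd h)) = ⟨0, v⟩ * ⟨-h v z, z⟩ := by ext <;> simp
  rw [basisVec, e, map_mul, Module.End.mul_apply, heisenbergRep_zetaVec hJ hz, map_smul]
  rfl

lemma apply_eq_zero_of_mem_span (hJ : ∀ a ∈ J, ∀ b ∈ J, σ a * b = 0)
    {s : Set V} {F : inducedModule h J ψ}
    (hF : F ∈ Submodule.span ℂ (basisVec h hJ ψ '' s)) {k : Heisenberg (biadd h)}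
    (hk : ∀ v ∈ s, k.vec - v ∉ (J • ⊤ : Submodule B V)) : F.1 k = 0 := by
  induction hF using Submodule.span_induction with
  | mem F hF =>
    obtain ⟨v, hv, rfl⟩ := hF
    refine zetaVec_apply_of_notMem hJ ?_
    simpa [neg_add_eq_sub] using hk v hv
  | zero => rfl
  | add F F' _ _ h1 h2 => rw [Submodule.coe_add, Pi.add_apply, h1, h2, add_zero]
  | smul c F _ h1 => rw [Submodule.coe_smul, Pi.smul_apply, h1, smul_zero]

/-- A subspace stable under `V₀` contains `ζ` once it has an element not vanishing at the identity,
provided that `V₀` is its own orthogonal space. -/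
lemma zetaVec_mem (hJ : ∀ a ∈ J, ∀ b ∈ J, σ a * b = 0)
    [Finite V]
    (hnd : ∀ v, v ∉ (J • ⊤ : Submodule B V) →
      ∃ z ∈ (J • ⊤ : Submodule B V), ψ (h z v - h v z) ≠ 1)
    (N : Submodule ℂ (inducedModule h J ψ))
    (hN : ∀ z ∈ (J • ⊤ : Submodule B V), ∀ F ∈ N, heisenbergRep h J ψ ⟨0, z⟩ F ∈ N)
    {F : inducedModule h J ψ} (hF : F ∈ N) (hF0 : F.1 ⟨0, 0⟩ ≠ 0) : zetaVec h hJ ψ ∈ N := by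
  classical
  have := Fintype.ofFinite (J • ⊤ : Submodule B V)
  -- Averaging over `V₀` multiplies the value of `F` at `k` by the character sum of `χ k.vec`. It
  -- vanishes off `V₀` by `hnd` and not at the identity, so `G` is a non-zero multiple of `ζ`.
  set G := ∑ z : (J • ⊤ : Submodule B V), heisenbergRep h J ψ ⟨0, z.1⟩ F with hG
  have hGN : G ∈ N := Submodule.sum_mem _ fun z _ => hN z.1 z.2 F hF
  let χ : V → AddChar (J • ⊤ : Submodule B V) ℂ := fun v =>
    ψ.compAddMonoidHom
      ((((biadd h).flip v - biadd h v)).comp (J • ⊤ : Submodule B V).subtype.toAddMonoidHom)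
  have hGapp : ∀ k, G.1 k = (∑ z, χ k.vec z) * F.1 k := fun k => by
    rw [Finset.sum_mul, hG, AddSubmonoidClass.coe_finsetSum, Finset.sum_apply]
    exact Finset.sum_congr rfl fun z _ => heisenbergRep_apply_of_mem hJ F z.2 k
  have h0 : ∀ k : Heisenberg (biadd h), k.vec ∉ (J • ⊤ : Submodule B V) → G.1 k = 0 := by
    intro k hk
    obtain ⟨z, hz, hne⟩ := hnd _ hk
    have : χ k.vec ≠ 0 := AddChar.ne_zero_iff.mpr ⟨⟨z, hz⟩, hne⟩
    rw [hGapp, AddChar.sum_eq_zero_iff_ne_zero.mpr this, zero_mul]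
  have h1 : G.1 ⟨0, 0⟩ ≠ 0 := by
    have : χ 0 = 0 := by
      ext z
      simp [χ]
    rw [hGapp]
    exact mul_ne_zero (AddChar.sum_ne_zero_iff_eq_zero.mpr this) hF0
  rw [eq_smul_zetaVec hJ G h0] at hGN
  exact (Submodule.smul_mem_iff _ h1).mp hGN

end Induced

/-! ### The submodules `Top` and `Bot` -/

/-- Serves twice for descent: from `U` to the reduced unitary group, and from `H(h)` to the reduced
Heisenberg group. -/
lemma exists_monoidHom_apply_eq {G H M : Type*} [Group G] [Group H] [Monoid M] (f : G →* H)
    (hf : Function.Surjective f) (g : G →* M) (hg : f.ker ≤ g.ker) :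
    ∃ k : H →* M, ∀ a, k (f a) = g a := by
  refine ⟨(QuotientGroup.lift f.ker g hg).comp
    (QuotientGroup.quotientKerEquivOfSurjective f hf).symm.toMonoidHom, fun a => ?_⟩
  have e : (QuotientGroup.quotientKerEquivOfSurjective f hf).symm (f a) = QuotientGroup.mk a := by
    rw [MulEquiv.symm_apply_eq]
    rfl
  change QuotientGroup.lift f.ker g hg
    ((QuotientGroup.quotientKerEquivOfSurjective f hf).symm (f a)) = g a
  rw [e]
  rfl

/-! ### Homomorphisms between Heisenberg groups, and invariance under isometries. -/

section HeisenbergHom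

variable {B V : Type*} [CommRing B] [AddCommGroup V] [Module B V] {σ : B →+* B}

/-- The natural homomorphism from the Heisenberg group of `h` to that of the reduced form. -/
def redHeisenberg (h : V →ₛₗ[σ] V →ₗ[B] B) {I : Ideal B} (hI : I ≤ I.comap σ) :
    Heisenberg (biadd h) →* Heisenberg (biadd (redForm h hI)) :=
  MonoidHom.mk' (fun k => ⟨Ideal.Quotient.mk I k.center, Submodule.Quotient.mk k.vec⟩)
    (fun _ _ => by ext <;> rfl)

lemma redHeisenberg_surjective (h : V →ₛₗ[σ] V →ₗ[B] B) {I : Ideal B} (hI : I ≤ I.comap σ) :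
    Function.Surjective (redHeisenberg h hI) := by
  rintro ⟨b, v⟩
  obtain ⟨b, rfl⟩ := Ideal.Quotient.mk_surjective b
  obtain ⟨v, rfl⟩ := Submodule.Quotient.mk_surjective _ v
  exact ⟨⟨b, v⟩, rfl⟩

/-- The endomorphism of `H(h)` that multiplies vectors by `c` and central elements by `c* c`. -/
def dilation (h : V →ₛₗ[σ] V →ₗ[B] B) (c : B) : Heisenberg (biadd h) →* Heisenberg (biadd h) :=
  MonoidHom.mk' (fun k => ⟨σ c * c * k.center, c • k.vec⟩) fun k k' => by
    ext
    · simp only [Heisenberg.mul_center, biadd_apply, map_smulₛₗ, LinearMap.smul_apply, smul_eq_mul,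
        RingHom.id_apply]
      ring
    · simp

/-- When `h` has trivial left radical, a representation of `H(h)` that is intertwined by a
representation of the unitary group is invariant under all additive isometries. -/
lemma exists_intertwiner {h : V →ₛₗ[σ] V →ₗ[B] B} (hinj : Function.Injective h) {X : Type*}
    [AddCommGroup X] [Module ℂ X] {S : Representation ℂ (Heisenberg (biadd h)) X}
    {W : Representation ℂ (unitaryGroup h) X}
    (hWS : ∀ (g : unitaryGroup h) (k : Heisenberg (biadd h)) (F : X),
      W g (S k F) = S (k.act g.1) (W g F)) :
    ∀ g ∈ isometryGroup (biadd h), ∃ P : X ≃ₗ[ℂ] X, ∀ (k : Heisenberg (biadd h)) (F : X),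
      P (S k F) = S (k.act g) (P F) := by
  intro g hg
  obtain ⟨k, hk⟩ := exists_unitary_eq_of_mem_isometryGroup hinj hg
  have hW : ∀ a b : unitaryGroup h, a * b = 1 → W a ∘ₗ W b = LinearMap.id := by
    intro a b hab
    rw [← Module.End.mul_eq_comp, ← map_mul, hab, map_one]
    rfl
  refine ⟨LinearEquiv.ofLinearMap (W k) (W k⁻¹) (hW _ _ (mul_inv_cancel k))
    (hW _ _ (inv_mul_cancel k)), fun m F => ?_⟩
  have e : m.act k.1 = m.act g := by
    ext1
    · rfl
    · exact hk _
  rw [LinearEquiv.coe_ofLinearMap, hWS, e]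

end HeisenbergHom

/-! ### The actions of the congruence subgroup and of the Heisenberg group. -/

section Ramified

variable {R : Type*} [CommRing R] {x : R} {V : Type*} [AddCommGroup V] [Module (Ext x) V]
  {h : V →ₛₗ[conj x] V →ₗ[Ext x] Ext x} {l : ℕ} {ψ : AddChar R ℂ}

lemma y_pow_smul_eq {i j n : ℕ} (hn : n = i + j) (v : V) :
    yElt x ^ n • v = yElt x ^ i • yElt x ^ j • v := by
  rw [hn, pow_add, mul_smul]

lemma not_isPrimitiveVec_iff {v : V} :
    ¬ IsPrimitiveVec (x := x) v ↔ ∃ w, v = yElt x • w := by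
  rw [IsPrimitiveVec, not_not, mem_yIdeal_smul_top, pow_one]

lemma not_isPrimitiveVec_of_mem (hl0 : 0 < l) {z : V}
    (hz : z ∈ (yIdeal x l • ⊤ : Submodule (Ext x) V)) : ¬ IsPrimitiveVec (x := x) z := by
  obtain ⟨w, rfl⟩ := mem_yIdeal_smul_top.mp hz
  exact not_isPrimitiveVec_iff.mpr
    ⟨yElt x ^ (l - 1) • w, by rw [← mul_smul, ← pow_succ', Nat.sub_add_cancel hl0]⟩

lemma bot_apply_eq_zero (hl0 : 0 < l) (hx0 : x ^ l = 0) {F : WeilModule h l ψ}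
    (hF : F ∈ Bot h hx0 ψ) {k : Heisenberg (biadd h)} (hk : IsPrimitiveVec (x := x) k.vec) :
    F.1 k = 0 :=
  apply_eq_zero_of_mem_span (yIdeal_isotropic x hx0) hF fun v hv hkv => hk <| by
    have := add_mem (not_not.mp (not_isPrimitiveVec_of_mem hl0 hkv)) (not_not.mp hv)
    rwa [sub_add_cancel] at this

lemma top_apply_eq_zero (hl0 : 0 < l) (hx0 : x ^ l = 0) {F : WeilModule h l ψ}
    (hF : F ∈ Top h hx0 ψ) {k : Heisenberg (biadd h)} (hk : ¬ IsPrimitiveVec (x := x) k.vec) :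
    F.1 k = 0 :=
  apply_eq_zero_of_mem_span (yIdeal_isotropic x hx0) hF fun v hv hkv => hv <| by
    have := sub_mem (not_not.mp hk) (not_not.mp (not_isPrimitiveVec_of_mem hl0 hkv))
    rwa [sub_sub_cancel] at this

/-- The scalar of `basisVec_add` is `1` because `y · y^(2ℓ-1) = 0`. Both the congruence subgroup and
the kernel of the Heisenberg reduction act trivially on `Bot` for this reason. -/
lemma basisVec_y_smul_add (hl0 : 0 < l) (hx0 : x ^ l = 0) (w u : V) :
    basisVec h (yIdeal_isotropic x hx0) (mu x ψ) (yElt x • w + yElt x ^ (2 * l - 1) • u)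
      = basisVec h (yIdeal_isotropic x hx0) (mu x ψ) (yElt x • w) := by
  have hz : yElt x ^ (2 * l - 1) • u ∈ (yIdeal x l • ⊤ : Submodule (Ext x) V) :=
    mem_yIdeal_smul_top.mpr ⟨_, y_pow_smul_eq (j := l - 1) (by omega) u⟩
  have := form_y_pow_smul_y_pow_smul (h := h) hx0 (i := 1) (j := 2 * l - 1) (by omega) w u
  rw [pow_one] at this
  rw [basisVec_add (yIdeal_isotropic x hx0) _ hz, this, neg_zero, AddChar.map_zero_eq_one, one_smul]

/-- The congruence subgroup `U(y^(2(ℓ-1)))` acts trivially on `Bot`. -/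
lemma weil_bot_eq_self (hl0 : 0 < l) (hx0 : x ^ l = 0) {g : unitaryGroup h}
    (hg : g ∈ congrSubgroup h (2 * (l - 1))) {F : WeilModule h l ψ} (hF : F ∈ Bot h hx0 ψ) :
    weil h l ψ g F = F := by
  refine LinearMap.eqOn_span (f := weilRep h (yIdeal x l) (mu x ψ) g) (g := LinearMap.id) ?_ hF
  rintro _ ⟨v, hv, rfl⟩
  obtain ⟨w, rfl⟩ := not_isPrimitiveVec_iff.mp hv
  obtain ⟨u, hu⟩ := mem_yIdeal_smul_top.mp (hg w)
  have e : yElt x • yElt x ^ (2 * (l - 1)) • u = yElt x ^ (2 * l - 1) • u := by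
    rw [y_pow_smul_eq (n := 2 * l - 1) (i := 1) (j := 2 * (l - 1)) (by omega), pow_one]
  rw [weilRep_basisVec, map_smul, sub_eq_iff_eq_add'.mp hu, smul_add, e,
    basisVec_y_smul_add hl0 hx0]
  rfl

/-- A primitive vector is moved within its coset modulo `V₀` by an element of the congruence
subgroup that multiplies the corresponding basis vector by a scalar different from `1`. -/
lemma exists_congr_mu_ne_one [Finite V] [Module.Free (Ext x) V] [IsLocalRing R]
    (h2 : IsUnit (2 : R)) (hx : Ideal.span {x} = IsLocalRing.maximalIdeal R) (hl0 : 0 < l)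
    (hx0 : x ^ l = 0) (hxl : x ^ (l - 1) ≠ 0) (hinj : Function.Injective h)
    (hherm : ∀ u v, h v u = star (h u v)) (hψ : ψ.IsPrimitive) {v : V}
    (hv : IsPrimitiveVec (x := x) v) :
    ∃ g ∈ congrSubgroup h (2 * (l - 1)), ∃ z ∈ (yIdeal x l • ⊤ : Submodule (Ext x) V),
      g.1 v = v + z ∧ mu x ψ (h v z) ≠ 1 := by
  obtain ⟨u, hu⟩ : ∃ u, h v u ∉ yIdeal x 1 := by
    by_contra! hc
    exact hv (mem_smul_top_of_form_mem hx hl0 hx0 hxl hinj (i := 2 * l - 1) (by omega) hc)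
  have hunit : IsUnit (h v u) := (isUnit_or_exists_eq_y_mul hx _).resolve_right
    fun ⟨b, hb⟩ => hu (mem_yIdeal.mpr ⟨b, by rwa [pow_one]⟩)
  obtain ⟨c, hc⟩ := hunit.exists_right_inv
  have hvu : h v (c • u) = 1 := by rw [map_smul, smul_eq_mul, mul_comm, hc]
  have huv : h (c • u) v = 1 := by rw [hherm v, hvu, star_one]
  -- Since `y^(2ℓ-1) = x^(ℓ-1) y`, the scalar to be produced is `ψ(2 x^(ℓ-1) r)`.
  obtain ⟨r, hr⟩ := AddChar.ne_one_iff.mp (hψ (a := 2 * x ^ (l - 1))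
    fun h0 => hxl (h2.mul_right_eq_zero.mp h0))
  obtain ⟨g, hg⟩ := exists_transvection hl0 hx0 hinj hherm r (c • u)
  refine ⟨g, fun w => ?_, yElt x ^ (2 * l - 1) • algebraMap R (Ext x) r • c • u,
    mem_yIdeal_smul_top.mpr ⟨yElt x ^ (l - 1) • algebraMap R (Ext x) r • c • u, ?_⟩, ?_, ?_⟩
  · rw [hg, add_sub_cancel_left]
    exact mem_yIdeal_smul_top.mpr ⟨_, y_pow_smul_eq (j := 1) (by omega) _⟩
  · exact y_pow_smul_eq (by omega) _
  · rw [hg, huv, mul_one]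
  · have e : 2 * l - 1 = 2 * (l - 1) + 1 := by omega
    have e2 : h v (yElt x ^ (2 * l - 1) • algebraMap R (Ext x) r • c • u)
        = algebraMap R (Ext x) (x ^ (l - 1)) * yElt x * algebraMap R (Ext x) r := by
      rw [map_smul, map_smul, hvu, e, pow_succ, pow_mul, y_sq, ← map_pow, smul_eq_mul, smul_eq_mul,
        mul_one]
    rw [e2, mu_apply]
    convert hr using 1
    rw [AddChar.mulShift_apply]
    congr 1
    simp [QuadraticAlgebra.im_mul, -map_pow]
    ring

/-- `Top` has no non-zero vector fixed by the congruence subgroup. -/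
lemma eq_zero_of_mem_top [Finite V] [Module.Free (Ext x) V] [IsLocalRing R]
    (h2 : IsUnit (2 : R)) (hx : Ideal.span {x} = IsLocalRing.maximalIdeal R) (hl0 : 0 < l)
    (hx0 : x ^ l = 0) (hxl : x ^ (l - 1) ≠ 0) (hinj : Function.Injective h)
    (hherm : ∀ u v, h v u = star (h u v)) (hψ : ψ.IsPrimitive) {F : WeilModule h l ψ}
    (hF : F ∈ Top h hx0 ψ)
    (hfix : ∀ g ∈ congrSubgroup h (2 * (l - 1)), weil h l ψ g F = F) : F = 0 := by
  ext k
  by_cases hk : IsPrimitiveVec (x := x) k.vec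
  · obtain ⟨g, hg, z, hz, hgz, hne⟩ :=
      exists_congr_mu_ne_one h2 hx hl0 hx0 hxl hinj hherm hψ hk
    -- The inverse is used because `g⁻¹` acts on functions by evaluation at `g k`.
    have h1 : F.1 (k.act (g⁻¹)⁻¹.1) = F.1 k :=
      congrArg (fun F : WeilModule h l ψ => F.1 k) (hfix g⁻¹ (inv_mem hg))
    rw [inv_inv] at h1
    have h3 : k.act g.1 = ⟨k.center, k.vec + z⟩ := by
      ext1
      · rfl
      · exact hgz
    rw [h3, inducedModule_apply_add F _ _ hz] at h1
    by_contra h0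
    exact hne (mul_right_cancel₀ h0 (h1.trans (one_mul _).symm))
  · exact top_apply_eq_zero hl0 hx0 hF hk

/-- `Bot` as a representation of `H(h)` through the dilation by `y`. -/
def botHeisenberg (h : V →ₛₗ[conj x] V →ₗ[Ext x] Ext x) (hx0 : x ^ l = 0) (ψ : AddChar R ℂ) :
    Subrepresentation ((heisenbergRep h (yIdeal x l) (mu x ψ)).comp (dilation h (yElt x))) where
  toSubmodule := (Bot h hx0 ψ).toSubmodule
  apply_mem_toSubmodule := fun k F hF => by
    refine (Submodule.span_le (p := (Bot h hx0 ψ).toSubmodule.comap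
      (heisenbergRep h (yIdeal x l) (mu x ψ) (dilation h (yElt x) k)))).mpr ?_ hF
    rintro _ ⟨v, hv, rfl⟩
    simp only [Submodule.comap_coe, Set.mem_preimage, SetLike.mem_coe]
    rw [heisenbergRep_basisVec]
    refine Submodule.smul_mem _ _ (Submodule.subset_span ⟨_, ?_, rfl⟩)
    obtain ⟨w, rfl⟩ := not_isPrimitiveVec_iff.mp hv
    exact not_isPrimitiveVec_iff.mpr ⟨k.vec + w, (smul_add _ _ _).symm⟩

/-- The identity `y* y = -y²` is the source of the sign in `muBar`. -/
lemma dilation_y_center (k : Heisenberg (biadd h)) :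
    (dilation h (yElt x) k).center = -yElt x ^ 2 * k.center := by
  change conj x (yElt x) * yElt x * k.center = _
  rw [conj_y]
  ring

/-- The dilation kills a centre in `y^(2(ℓ-1)) A` and sends a vector of `y^(2(ℓ-1)) V` into
`y^(2ℓ-1) V`, which is orthogonal to `y V` and does not change `e_{yw}`. -/
lemma ker_redHeisenberg_le (hl : 1 < l) (hx0 : x ^ l = 0) :
    (redHeisenberg h (yIdeal_le_comap x (2 * (l - 1)))).ker
      ≤ (botHeisenberg h hx0 ψ).toRepresentation.ker := by
  intro k hk
  rw [MonoidHom.mem_ker] at hk ⊢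
  have hc : k.center ∈ yIdeal x (2 * (l - 1)) :=
    Ideal.Quotient.eq_zero_iff_mem.mp (congrArg Heisenberg.center hk)
  have hv : k.vec ∈ (yIdeal x (2 * (l - 1)) • ⊤ : Submodule (Ext x) V) :=
    (Submodule.Quotient.mk_eq_zero _).mp (congrArg Heisenberg.vec hk)
  obtain ⟨b, hb⟩ := mem_yIdeal.mp hc
  obtain ⟨u, hu⟩ := mem_yIdeal_smul_top.mp hv
  have e : dilation h (yElt x) k = ⟨0, yElt x ^ (2 * l - 1) • u⟩ := by
    ext1
    · have e2 : 2 + 2 * (l - 1) = 2 * l := by omega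
      rw [dilation_y_center, hb, neg_mul, ← mul_assoc, ← pow_add, e2, y_pow_two_mul x hx0, zero_mul,
        neg_zero]
    · change yElt x • k.vec = _
      rw [hu, y_pow_smul_eq (n := 2 * l - 1) (i := 1) (j := 2 * (l - 1)) (by omega), pow_one]
  refine LinearMap.ext fun F => Subtype.ext ?_
  change heisenbergRep h (yIdeal x l) (mu x ψ) (dilation h (yElt x) k) F.1 = F.1
  rw [e]
  refine LinearMap.eqOn_span (f := heisenbergRep h (yIdeal x l) (mu x ψ)
    ⟨0, yElt x ^ (2 * l - 1) • u⟩) (g := LinearMap.id) ?_ F.2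
  rintro _ ⟨v, hv, rfl⟩
  obtain ⟨w, rfl⟩ := not_isPrimitiveVec_iff.mp hv
  have h0 := form_y_pow_smul_y_pow_smul (h := h) hx0 (i := 2 * l - 1) (j := 1) (by omega) u w
  rw [pow_one] at h0
  rw [heisenbergRep_basisVec, h0, add_zero, AddChar.map_zero_eq_one, one_smul, add_comm,
    basisVec_y_smul_add (by omega) hx0]
  rfl

/-- This is the maximality of `V₀`: a vector orthogonal to `V₀` under the commutator pairing lies in
`V₀`. -/
lemma exists_mu_commutator_ne_one [Module.Free (Ext x) V] [IsLocalRing R]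
    (h2 : IsUnit (2 : R)) (hx : Ideal.span {x} = IsLocalRing.maximalIdeal R) (hl0 : 0 < l)
    (hx0 : x ^ l = 0) (hxl : x ^ (l - 1) ≠ 0) (hinj : Function.Injective h)
    (hherm : ∀ u v, h v u = star (h u v)) (hψ : ψ.IsPrimitive) {v : V}
    (hv : v ∉ (yIdeal x l • ⊤ : Submodule (Ext x) V)) :
    ∃ z ∈ (yIdeal x l • ⊤ : Submodule (Ext x) V), mu x ψ (h z v - h v z) ≠ 1 := by
  obtain ⟨w, hw⟩ : ∃ w, h v w ∉ yIdeal x l := by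
    by_contra! hc
    exact hv (mem_smul_top_of_form_mem hx hl0 hx0 hxl hinj (two_mul l).symm hc)
  obtain ⟨b, hb⟩ := exists_mu_mul_ne_one h2 hψ (a := yElt x ^ l * h v w)
    fun h0 => hw (mem_yIdeal_of_y_pow_mul_eq_zero hx hl0 hxl (two_mul l).symm h0)
  obtain ⟨c, hc⟩ := h2.exists_right_inv
  -- With `2 c = 1`, the factor `-c` makes the commutator and `t = y^ℓ h(v, w) b` agree in their
  -- `y`-coordinate, hence under `μ`.
  refine ⟨yElt x ^ l • (algebraMap R (Ext x) (-c) * b) • w, mem_yIdeal_smul_top.mpr ⟨_, rfl⟩, ?_⟩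
  have e : h v (yElt x ^ l • (algebraMap R (Ext x) (-c) * b) • w)
      = algebraMap R (Ext x) (-c) * (yElt x ^ l * h v w * b) := by
    rw [map_smul, map_smul, smul_eq_mul, smul_eq_mul]
    ring
  rw [hherm v, e]
  set t := yElt x ^ l * h v w * b
  have e2 : (star (algebraMap R (Ext x) (-c) * t) - algebraMap R (Ext x) (-c) * t).im = t.im := by
    rw [QuadraticAlgebra.im_sub, QuadraticAlgebra.im_star, QuadraticAlgebra.im_mul,
      QuadraticAlgebra.algebraMap_re, QuadraticAlgebra.algebraMap_im]
    linear_combination t.im * hc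
  rwa [mu_apply, e2, ← mu_apply]

/-- `Bot` is irreducible under the Heisenberg group. -/
lemma eq_bot_of_le_of_stable [Finite V] [Module.Free (Ext x) V] [IsLocalRing R]
    (h2 : IsUnit (2 : R)) (hx : Ideal.span {x} = IsLocalRing.maximalIdeal R) (hl0 : 0 < l)
    (hx0 : x ^ l = 0) (hxl : x ^ (l - 1) ≠ 0) (hinj : Function.Injective h)
    (hherm : ∀ u v, h v u = star (h u v)) (hψ : ψ.IsPrimitive)
    {N : Submodule ℂ (WeilModule h l ψ)} (hN : N ≤ (Bot h hx0 ψ).toSubmodule)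
    (hst : ∀ w : V, ∀ F ∈ N,
      heisenbergRep h (yIdeal x l) (mu x ψ) ⟨0, yElt x • w⟩ F ∈ N) {F : WeilModule h l ψ}
    (hF : F ∈ N) (hF0 : F ≠ 0) : N = (Bot h hx0 ψ).toSubmodule := by
  refine le_antisymm hN ?_
  obtain ⟨k, hk⟩ : ∃ k, F.1 k ≠ 0 := by
    by_contra! hc
    exact hF0 (Subtype.ext (funext hc))
  have hkv : ¬ IsPrimitiveVec (x := x) k.vec :=
    fun hp => hk (bot_apply_eq_zero hl0 hx0 (hN hF) hp)
  obtain ⟨w, hw⟩ := not_isPrimitiveVec_iff.mp hkv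
  have hk0 : F.1 ⟨0, k.vec⟩ ≠ 0 := by
    intro h0
    refine hk ?_
    change F.1 ⟨k.center, k.vec⟩ = 0
    rw [inducedModule_apply_eq, h0, mul_zero]
  -- `F` is non-zero at `k.vec = y w`; translating by `-y w` brings this point to the identity,
  -- where `zetaVec_mem` applies.
  have hζ : zetaVec h (yIdeal_isotropic x hx0) (mu x ψ) ∈ N := by
    refine zetaVec_mem (yIdeal_isotropic x hx0) (fun v hv =>
      exists_mu_commutator_ne_one h2 hx hl0 hx0 hxl hinj hherm hψ hv) N (fun z hz F hF => ?_)
      (hst (-w) F hF) ?_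
    · obtain ⟨u, rfl⟩ := not_isPrimitiveVec_iff.mp (not_isPrimitiveVec_of_mem hl0 hz)
      exact hst u F hF
    · have e : (⟨0, yElt x • -w⟩ : Heisenberg (biadd h))⁻¹ * ⟨0, 0⟩
          = ⟨h k.vec k.vec, k.vec⟩ := by ext1 <;> simp [hw, mul_left_comm]
      rw [heisenbergRep_apply, e, inducedModule_apply_eq]
      exact mul_ne_zero (inv_ne_zero ((mu x ψ).val_isUnit _).ne_zero) hk0
  refine Submodule.span_le.mpr ?_
  rintro _ ⟨v, hv, rfl⟩
  obtain ⟨u, rfl⟩ := not_isPrimitiveVec_iff.mp hv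
  exact hst u _ hζ

/-- `Bot` is a Weil module of type `μ̄` for the unitary group of the reduced form. -/
lemma bot_isWeil [Finite V] [Module.Free (Ext x) V] [IsLocalRing R]
    (h2 : IsUnit (2 : R)) (hx : Ideal.span {x} = IsLocalRing.maximalIdeal R) (hl : 1 < l)
    (hx0 : x ^ l = 0) (hxl : x ^ (l - 1) ≠ 0) (hinj : Function.Injective h)
    (hherm : ∀ u v, h v u = star (h u v)) (hψ : ψ.IsPrimitive)
    (hsurj : Function.Surjective (toUBar h l))
    (W : Representation ℂ (unitaryGroup (hBar h l)) (Bot h hx0 ψ).toSubmodule)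
    (hW : ∀ g : unitaryGroup h, W (toUBar h l g) = (Bot h hx0 ψ).toRepresentation g) :
    IsWeil (X := (Bot h hx0 ψ).toSubmodule) (hBar h l) (muBar x hx0 hl ψ) W := by
  set π := redHeisenberg h (yIdeal_le_comap x (2 * (l - 1)))
  obtain ⟨S, hS⟩ := exists_monoidHom_apply_eq π (redHeisenberg_surjective h _)
    (botHeisenberg h hx0 ψ).toRepresentation (ker_redHeisenberg_le hl hx0)
  change Representation ℂ (Heisenberg (biadd (hBar h l))) (Bot h hx0 ψ).toSubmodule at S
  have hS' : ∀ k (F : (Bot h hx0 ψ).toSubmodule), (S (π k) F).1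
      = heisenbergRep h (yIdeal x l) (mu x ψ) (dilation h (yElt x) k) F.1 := fun k F =>
     congrArg Subtype.val (LinearMap.congr_fun (hS k) F)
  have hWS : ∀ (g : unitaryGroup (hBar h l)) (k : Heisenberg (biadd (hBar h l)))
      (F : (Bot h hx0 ψ).toSubmodule), W g (S k F) = S (k.act g.1) (W g F) := by
    intro g k F
    obtain ⟨g, rfl⟩ := hsurj g
    obtain ⟨k, rfl⟩ := redHeisenberg_surjective h (yIdeal_le_comap x (2 * (l - 1))) k
    have e : (π k).act (toUBar h l g).1 = π (k.act g.1) := rfl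
    -- Linearity of `g` makes it commute with the dilation, so the intertwining relation on `X`
    -- passes to `Bot`.
    have e2 : dilation h (yElt x) (k.act g.1) = (dilation h (yElt x) k).act g.1 := by
      ext1
      · rfl
      · exact (map_smul g.1 (yElt x) k.vec).symm
    refine Subtype.ext ?_
    change _ = (S ((π k).act (toUBar h l g).1) _).1
    rw [e, hS', hW, e2]
    change weilRep h (yIdeal x l) (mu x ψ) g (S (π k) F).1 = _
    rw [hS', weilRep_heisenbergRep]
    rfl
  refine ⟨S, ⟨?_, ?_, ?_⟩, hWS⟩
  · have hζ : zetaVec h (yIdeal_isotropic x hx0) (mu x ψ) ∈ (Bot h hx0 ψ).toSubmodule := by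
      refine Submodule.subset_span ⟨0, not_isPrimitiveVec_iff.mpr ⟨0, (smul_zero _).symm⟩, ?_⟩
      exact LinearMap.congr_fun (map_one (heisenbergRep h (yIdeal x l) (mu x ψ))) _
    have hζ0 : zetaVec h (yIdeal_isotropic x hx0) (mu x ψ) ≠ 0 := fun h0 => by
      have := zetaVec_apply_zero (h := h) (ψ := mu x ψ) (yIdeal_isotropic x hx0)
      rw [h0] at this
      exact zero_ne_one this
    refine { exists_pair_ne := ⟨⊥, ⊤, fun hbt => ?_⟩, eq_bot_or_eq_top := fun N => ?_ }
    · have : (⟨_, hζ⟩ : (Bot h hx0 ψ).toSubmodule) ∈ (⊥ : Subrepresentation S) := by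
        rw [hbt]
        exact Submodule.mem_top
      exact hζ0 (congrArg Subtype.val ((Submodule.mem_bot ℂ).mp this))
    · by_cases hN : N.toSubmodule = ⊥
      · exact Or.inl (Subrepresentation.toSubmodule_injective hN)
      · right
        obtain ⟨F, hF, hF0⟩ := Submodule.exists_mem_ne_zero_of_ne_bot hN
        -- `N` is viewed inside `X`; its stability under `S` becomes stability under translation by
        -- `y V`.
        have h1 := eq_bot_of_le_of_stable h2 hx (by omega) hx0 hxl hinj hherm hψ
          (N := N.toSubmodule.map (Bot h hx0 ψ).toSubmodule.subtype)
          (Submodule.map_subtype_le _ _) ?_ (Submodule.mem_map_of_mem hF)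
          (fun h0 => hF0 (Subtype.ext h0))
        · refine Subrepresentation.toSubmodule_injective (eq_top_iff.mpr fun G _ => ?_)
          obtain ⟨G', hG', hGG⟩ := h1.ge G.2
          rwa [← Subtype.ext hGG]
        · rintro w _ ⟨G, hG, rfl⟩
          refine ⟨S (π ⟨0, w⟩) G, N.apply_mem_toSubmodule _ hG, ?_⟩
          refine (hS' _ _).trans ?_
          have e : dilation h (yElt x) ⟨0, w⟩ = ⟨0, yElt x • w⟩ := by
            ext1
            · exact mul_zero _
            · rfl
          rw [e]
          rfl
  · intro b F
    obtain ⟨b, rfl⟩ := Ideal.Quotient.mk_surjective b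
    refine Subtype.ext ((hS' ⟨b, 0⟩ F).trans ?_)
    have e : dilation h (yElt x) ⟨b, 0⟩ = ⟨-yElt x ^ 2 * b, 0⟩ := by
      ext1
      · exact dilation_y_center _
      · exact smul_zero _
    rw [e, heisenbergRep_central, muBar_mk]
    rfl
  · have hinj' := hBar_injective hx (by omega) hx0 hxl hinj
    exact @exists_intertwiner _ _ _ _ _ _ (hBar h l) hinj' (Bot h hx0 ψ).toSubmodule _ _ S W hWS

end Ramified
end RamifiedWeil

open RamifiedWeil in
theorem mainTheorem7 {R : Type*} [CommRing R] [Finite R] [IsLocalRing R] [IsPrincipalIdealRing R]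
    (hodd : Odd (ringChar R))
    (x : R) (hx : Ideal.span {x} = IsLocalRing.maximalIdeal R)
    (l : ℕ) (hl : nilpotencyClass (IsLocalRing.maximalIdeal R) = l)
    {V : Type*} [AddCommGroup V] [Nontrivial V] [Module (Ext x) V] [Module.Free (Ext x) V]
    [Module.Finite (Ext x) V]
    (h : V →ₛₗ[conj x] V →ₗ[Ext x] Ext x)
    (hherm : ∀ u v, h v u = star (h u v))
    (hnondeg : Function.Bijective h)
    (ψ : AddChar R ℂ) (hψ : ψ.IsPrimitive) :
    -- the congruence subgroup acts trivially on `Bot`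
    (∀ g ∈ congrSubgroup h (2 * (l - 1)), ∀ F ∈ Bot h (x_pow_eq_zero hx hl) ψ,
      weil h l ψ g F = F) ∧
    -- and nontrivially on every irreducible constituent of `Top`
    (∀ P : Subrepresentation (weil h l ψ), P ≤ Top h (x_pow_eq_zero hx hl) ψ →
      Representation.IsIrreducible (V := P.toSubmodule) P.toRepresentation →
      ∃ g ∈ congrSubgroup h (2 * (l - 1)), ∃ F ∈ P, weil h l ψ g F ≠ F) ∧
    -- for `ℓ > 1`, the reduction map induces an isomorphism from the quotient of the unitary group
    -- by the congruence subgroup onto the unitary group of the reduced form, and `Bot` is a Weil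
    -- module of primitive type for the latter
    (∀ hl1 : 1 < l,
      Function.Surjective (toUBar h l) ∧
      (toUBar h l).ker = congrSubgroup h (2 * (l - 1)) ∧
      (muBar x (x_pow_eq_zero hx hl) hl1 ψ).IsPrimitive ∧
      ∃ W : Representation ℂ (unitaryGroup (hBar h l)) (Bot h (x_pow_eq_zero hx hl) ψ).toSubmodule,
        (∀ g : unitaryGroup h,
          W (toUBar h l g) = (Bot h (x_pow_eq_zero hx hl) ψ).toRepresentation g) ∧
        IsWeil (X := (Bot h (x_pow_eq_zero hx hl) ψ).toSubmodule) (hBar h l)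
          (muBar x (x_pow_eq_zero hx hl) hl1 ψ) W) := by
  have hl0 : 0 < l := by
    rw [Nat.pos_iff_ne_zero]
    -- With `ℓ = 0` the relation `x ^ ℓ = 0` would read `1 = 0`.
    rintro rfl
    have h1 : x ^ 0 = 0 := x_pow_eq_zero hx hl
    exact one_ne_zero ((pow_zero x).symm.trans h1)
  have hx0 := x_pow_eq_zero hx hl
  have hxl := pow_pred_ne_zero hx hl hl0
  have h2 := isUnit_two_of_odd_ringChar hodd
  have : Finite (Ext x) := Finite.of_equiv _ (QuadraticAlgebra.equivProd x 0).symm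
  have : Finite V := Module.finite_of_finite (Ext x)
  refine ⟨fun g hg F hF => weil_bot_eq_self hl0 hx0 hg hF, fun P hP hirr => ?_, fun hl1 => ?_⟩
  -- A constituent fixed pointwise would be zero, hence without two distinct subrepresentations.
  · by_contra! hc
    obtain ⟨N, N', hne⟩ := hirr.exists_pair_ne
    refine hne (Subrepresentation.toSubmodule_injective (Submodule.ext fun F => ?_))
    have hF : F = 0 := Subtype.ext (eq_zero_of_mem_top h2 hx hl0 hx0 hxl hnondeg.1 hherm hψ
      (hP F.2) fun g hg => hc g hg F.1 F.2)
    rw [hF]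
    exact iff_of_true (zero_mem _) (zero_mem _)
  · have hsurj := toUBar_surjective h2 hx hl1 hx0 hxl hnondeg hherm
    have hker := ker_redHom h (yIdeal_le_comap x (2 * (l - 1)))
    refine ⟨hsurj, hker, muBar_isPrimitive h2 hx hl1 hx0 hxl hψ, ?_⟩
    obtain ⟨W, hW⟩ := exists_monoidHom_apply_eq (toUBar h l) hsurj
      (Bot h hx0 ψ).toRepresentation fun g hg => by
        rw [hker] at hg
        exact LinearMap.ext fun F => Subtype.ext (weil_bot_eq_self hl0 hx0 hg F.2)
    exact ⟨W, hW, bot_isWeil h2 hx hl1 hx0 hxl hnondeg.1 hherm hψ hsurj W hW⟩
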